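/- Let $\mathcal M$ be the Euclidean plane $\mathbb E^2=\mathbb C$, the unit sphere $\mathbb S^2\subset\mathbb R^3$, or the hyperbolic plane $\mathbb H^2$ (the Poincaré disk in $\mathbb C$ with Möbius addition $z\oplus w=\frac{z+w}{1+\bar z w}$ and $d(z,w)=2\operatorname{artanh}|(-z)\oplus w|$), with geodesic distance $d$. Let $\mathcal A=[-\alpha_{\max},\alpha_{\max}]$ with $\alpha_{\max}=\frac{\pi}{4}-0.02$. For a closed polygon $\mathbf P=(p_j)_{j\in\mathbb Z/N}$ in $\mathcal M$ let $e_j=d(p_j,p_{j+1})$, $\bar e=\frac1N\sum_j e_j$, $h(\mathbf P)=\max_j e_j$, let $\delta_j\in(-\pi,\pi]$ be the signed exterior angle at $p_j$ (positive for counter-clockwise turns), and put $$\mathbf x_j=\Bigl[\tfrac{\delta_{j-1}}\pi,\tfrac{\delta_j}\pi,\tfrac{\delta_{j+1}}\pi,\tfrac{\delta_{j+2}}\pi,\tfrac{e_j}{\bar e},\tfrac{e_{j+1}}{\bar e},\kappa\Bigr]\in\mathbb R^7,\qquad \kappa=0,+1,-1\ \text{on}\ \mathbb E^2,\mathbb S^2,\mathbb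 H^2;$$ the first four entries form the exterior-angle feature vector $\mathbf x_j^{\angle}$. For $\alpha\in\mathcal A$ let $q_j(\alpha)$ be the apex of the isosceles geodesic triangle over the edge $p_jp_{j+1}$ whose signed base angle at $p_j$ is $\alpha$; thus $d(p_j,q_j(\alpha))$ equals $\frac{e_j}{2\cos\alpha}$ on $\mathbb E^2$, $\arctan\frac{\tan(e_j/2)}{\cos\alpha}$ on $\mathbb S^2$ and $\operatorname{artanh}\frac{\tanh(e_j/2)}{\cos\alpha}$ on $\mathbb H^2$. Angles $\alpha$ are measured counter-clockwise or clockwise; fix either convention. A subdivision step keeps the vertices ($q_{2j}=p_j$) and inserts $q_{2j+1}=q_j(\alpha_j)$. The neural scheme $S_\theta$ of a predictor $f_\theta:\mathbb R^7\to\mathcal A$ uses $\alpha_j=f_\theta(\mathbf x_j)$; the four-point scheme $S_0$ uses $\alpha_j=\frac18(\delta_j+\delta_{j+1})$, clamped to $\mathcal A$. Let $f_\theta:\mathbb R^7\to\mathcal A$ be any function, let $\mathbf P^{(0)}$ be a closed polygon, $\mathbf P^{(k+1)}=S_\theta\mathbf P^{(k)}$ and $h_k=h(\mathbf P^{(k)})$.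 Assume that all $\mathbf P^{(k)}$ are non-degenerate: consecutive vertices are distinct, on $\mathbb S^2$ they are not antipodal, and on $\mathbb H^2$ $\tanh(e_j/2)<\cos\alpha_{\max}$ for all edges (so that all insertions with angles in $\mathcal A$ are defined). Assume further that $h_k\to0$ and that the exterior-angle features are $O(h_k)$: there is $K$ with $\|\mathbf x_j^{\angle}(\mathbf P^{(k)})\|_\infty\le K h_k$ for all $k$ and $j$. Then: 1. $S_\theta$ is $O(h^2)$-proximate to $S_0$ along the subdivision sequence: there is $C'$ with $$d\bigl((S_\theta\mathbf P^{(k)})_j,(S_0\mathbf P^{(k)})_j\bigr)\le C' h_k^2\qquad\text{for all }k,j.$$ Moreover there are $C$ and $\eta>0$ depending only on $\mathcal M$, $K$ and the angle convention (not on $f_\theta$, $N$ or $\mathbf P^{(0)}$) such that the bound holds with $C$ in place of $C'$ for all $k$ with $h_k\le\eta$. 2. The polygons $\mathbf P^{(k)}$ converge uniformly to a closed $C^1$ limit curve in $\mathcal M$ (in particular this is so whenever the iterates of $S_0$ have a $C^1$ limit curve): there are a $1$-periodic $C^1$ map $\gamma:\mathbb R\to\mathcal M$ with nowhere vanishing derivative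 and a continuous strictly increasing $\varphi:\mathbb R\to\mathbb R$ with $\varphi(t+1)=\varphi(t)+1$ such that $\sup_j d\bigl(p^{(k)}_j,\gamma(\varphi(j/(2^kN)))\bigr)\to0$. -/

import Mathlib

open Filter

noncomputable section

namespace AngleSubdivision

/-- The largest admissible insertion angle. -/
def alphaMax : ℝ := Real.pi / 4 - 0.02

/-- The admissible interval of insertion angles. -/
def admissibleAngles : Set ℝ := Set.Icc (-alphaMax) alphaMax

/-- Projection of a real number onto the admissible interval. -/
def clampAngle (a : ℝ) : ℝ := max (-alphaMax) (min alphaMax a)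

/-- The data that an angle-based scheme uses. Only the three instances `euclideanPlane`,
`sphere`, `hyperbolicPlane` below are ever considered. -/
structure Model where
  /-- ambient normed space of the model -/
  V : Type
  [grp : NormedAddCommGroup V]
  [mod : NormedSpace ℝ V]
  /-- the points of the model -/
  carrier : Set V
  /-- geodesic distance -/
  gdist : V → V → ℝ
  /-- `extAngle a p b`: signed exterior angle at `p` of the polygon `a, p, b` -/
  extAngle : V → V → V → ℝ
  /-- `insertPt p q α`: apex of the isosceles geodesic triangle over the edge `p q` whose
  signed base angle at `p` is `α` -/
  insertPt : V → V → ℝ → V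
  /-- the edge `p q` has a direction at both ends, and vertex insertion on it is
  well defined for every admissible angle -/
  goodEdge : V → V → Prop
  /-- geometry code -/
  code : ℝ

attribute [instance] Model.grp Model.mod

/-- `atan2 y x`. -/
def atan2 (y x : ℝ) : ℝ := Complex.arg ⟨x, y⟩

/-! ### The Euclidean plane (identified with `ℂ`) -/

/-- Unit vector from `p` towards `q`. -/
def eDir (p q : ℂ) : ℂ := (q - p) / (‖q - p‖ : ℂ)

/-- Signed angle from the plane vector `v` to the plane vector `w`:
`atan2` of the cross product and the inner product. -/
def planeAngle (v w : ℂ) : ℝ := atan2 (v.re * w.im - v.im * w.re) (v.re * w.re + v.im * w.im)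

/-- Counter-clockwise rotation of the plane by the angle `α`. -/
def rot (α : ℝ) (v : ℂ) : ℂ := Complex.exp (α * Complex.I) * v

/-- The new edge length is `sin |α| / sin (π - 2|α|)` times the old one; this ratio is
written as `1 / (2 cos α)`, its continuous extension to `α = 0`. -/
def euclideanPlane : Model where
  V := ℂ
  carrier := Set.univ
  gdist p q := ‖q - p‖
  extAngle a p b := planeAngle (eDir a p) (eDir p b)
  insertPt p q α := p + ((‖q - p‖ / (2 * Real.cos α) : ℝ) : ℂ) * rot α (eDir p q)
  goodEdge p q := p ≠ q
  code := 0

/-! ### The unit sphere in `ℝ³` -/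

abbrev R3 : Type := EuclideanSpace ℝ (Fin 3)

/-- Cross product of `ℝ³`. -/
def cross (v w : R3) : R3 := WithLp.toLp 2 (crossProduct (WithLp.ofLp v) (WithLp.ofLp w))

/-- Unit tangent at `p` towards `q`. -/
def sDir (p q : R3) : R3 :=
  (‖q - inner ℝ p q • p‖)⁻¹ • (q - inner ℝ p q • p)

/-- Great-circle distance. -/
def sDist (p q : R3) : ℝ := Real.arccos (inner ℝ p q)

/-- Length of the two new edges. -/
def sNew (p q : R3) (α : ℝ) : ℝ := Real.arctan (Real.tan (sDist p q / 2) / Real.cos α)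

def sphere : Model where
  V := R3
  carrier := Metric.sphere 0 1
  gdist := sDist
  extAngle a p b :=
    atan2 (inner ℝ (cross (-sDir p a) (sDir p b)) p) (inner ℝ (-sDir p a) (sDir p b))
  insertPt p q α :=
    Real.cos (sNew p q α) • p +
      Real.sin (sNew p q α) • (Real.cos α • sDir p q + Real.sin α • cross p (sDir p q))
  goodEdge p q := p ≠ q ∧ p ≠ -q
  code := 1

/-! ### The hyperbolic plane (Poincaré disk in `ℂ`) -/

/-- Möbius addition; in complex notation
`((1 + 2⟨z,w⟩ + ‖w‖²) z + (1 - ‖z‖²) w) / (1 + 2⟨z,w⟩ + ‖z‖²‖w‖²) = (z + w) / (1 + z̄ w)`. -/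
def mobiusAdd (z w : ℂ) : ℂ := (z + w) / (1 + (starRingEnd ℂ) z * w)

/-- Hyperbolic distance. -/
def hDist (z w : ℂ) : ℝ := 2 * Real.artanh ‖mobiusAdd (-z) w‖

/-- Unit tangent direction at `z` towards `w`. -/
def hDir (z w : ℂ) : ℂ := mobiusAdd (-z) w / (‖mobiusAdd (-z) w‖ : ℂ)

/-- Length of the two new edges. -/
def hNew (z w : ℂ) (α : ℝ) : ℝ := Real.artanh (Real.tanh (hDist z w / 2) / Real.cos α)

def hyperbolicPlane : Model where
  V := ℂ
  carrier := Metric.ball 0 1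
  gdist := hDist
  extAngle a p b := planeAngle (-hDir p a) (hDir p b)
  insertPt p q α :=
    mobiusAdd p ((Real.tanh (hNew p q α / 2) : ℂ) * rot α (hDir p q))
  goodEdge p q := p ≠ q ∧ Real.tanh (hDist p q / 2) < Real.cos alphaMax
  code := -1

/-- The three geometries. -/
inductive Geometry
  | euclidean
  | spherical
  | hyperbolic

/-- The model space of each geometry. -/
def Geometry.model : Geometry → Model
  | .euclidean => euclideanPlane
  | .spherical => sphere
  | .hyperbolic => hyperbolicPlane

/-! ### Closed polygons

A closed polygon with `N` vertices is a map `P : ℤ → M.V` of period `N`. -/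

section Polygon

variable (M : Model)

/-- `P` is a closed polygon of `M` with `N` vertices. -/
def IsClosedPolygon (N : ℕ) (P : ℤ → M.V) : Prop :=
  0 < N ∧ (∀ j, P (j + N) = P j) ∧ ∀ j, P j ∈ M.carrier

/-- Geodesic length of the edge from `P j` to `P (j+1)`. -/
def edge (P : ℤ → M.V) (j : ℤ) : ℝ := M.gdist (P j) (P (j + 1))

/-- Mean edge length. -/
def meanEdge (N : ℕ) (P : ℤ → M.V) : ℝ := (∑ i ∈ Finset.range N, edge M P i) / N

/-- Mesh width: the largest of the `N` edge lengths. -/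
def meshWidth (N : ℕ) (P : ℤ → M.V) : ℝ := ⨆ i : Fin N, edge M P (i : ℕ)

/-- Signed exterior angle at the vertex `P j`. -/
def delta (P : ℤ → M.V) (j : ℤ) : ℝ := M.extAngle (P (j - 1)) (P j) (P (j + 1))

/-- The seven-dimensional feature vector of the edge `j`. -/
def feature (N : ℕ) (P : ℤ → M.V) (j : ℤ) : Fin 7 → ℝ :=
  ![delta M P (j - 1) / Real.pi, delta M P j / Real.pi,
    delta M P (j + 1) / Real.pi, delta M P (j + 2) / Real.pi,
    edge M P j / meanEdge M N P, edge M P (j + 1) / meanEdge M N P, M.code]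

/-- The exterior-angle features of the edge `j`: the first four entries of `feature`. -/
def angleFeature (N : ℕ) (P : ℤ → M.V) (j : ℤ) : Fin 4 → ℝ :=
  fun i => feature M N P j (Fin.castLE (by norm_num) i)

/-- One subdivision step with insertion angle `a j` on the edge `j`: old vertices are kept,
`q (2j) = p j`, and `q (2j+1)` is inserted on the edge `j`. The sign `s = ±1` is the sense
in which insertion angles are measured: counter-clockwise for `1`, clockwise for `-1`. -/
def subdivide (s : ℝ) (a : ℤ → ℝ) (P : ℤ → M.V) : ℤ → M.V := fun i =>
  if i % 2 = 0 then P (i / 2) else M.insertPt (P (i / 2)) (P (i / 2 + 1)) (s * a (i / 2))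

/-- The scheme `S_θ` of the predictor `f`, applied to a polygon with `N` vertices. -/
def neuralStep (s : ℝ) (f : (Fin 7 → ℝ) → ℝ) (N : ℕ) (P : ℤ → M.V) : ℤ → M.V :=
  subdivide M s (fun j => f (feature M N P j)) P

/-- Insertion angle of the classical rule with tension `μ`. -/
def classicalAngle (μ : ℝ) (P : ℤ → M.V) (j : ℤ) : ℝ :=
  clampAngle
    ((μ * (delta M P (j - 1) + delta M P (j + 2)) + (1 - μ) * (delta M P j + delta M P (j + 1))) / 8)

/-- The four-point scheme `S_0`: the classical rule with `μ = 0`. -/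
def fourPointStep (s : ℝ) (P : ℤ → M.V) : ℤ → M.V :=
  subdivide M s (classicalAngle M 0 P) P

/-- The polygon with `N * 2 ^ k` vertices after `k` steps of `S_θ`. -/
def neuralIter (s : ℝ) (f : (Fin 7 → ℝ) → ℝ) (N : ℕ) (P : ℤ → M.V) : ℕ → ℤ → M.V
  | 0 => P
  | k + 1 => neuralStep M s f (N * 2 ^ k) (neuralIter s f N P k)

/-- Mesh widths tend to zero, and the exterior-angle features are at most `K` times the mesh
width along the sequence `P 0, P 1, …`, where `P k` has `N * 2 ^ k` vertices. -/
def AngleDecay (K : ℝ) (N : ℕ) (P : ℕ → ℤ → M.V) : Prop :=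
  Tendsto (fun k => meshWidth M (N * 2 ^ k) (P k)) atTop (nhds 0) ∧
    ∀ k j, ‖angleFeature M (N * 2 ^ k) (P k) j‖ ≤ K * meshWidth M (N * 2 ^ k) (P k)

/-- The polygons `P k` (with `N * 2 ^ k` vertices) converge uniformly to a closed regular `C¹`
curve of `M`: `γ` is a `1`-periodic `C¹` parametrization with nowhere vanishing derivative, and
`φ` relates the dyadic parameters of the vertices to the parameter of `γ`. -/
def HasC1LimitCurve (N : ℕ) (P : ℕ → ℤ → M.V) : Prop :=
  ∃ (γ : ℝ → M.V) (φ : ℝ → ℝ),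
    ContDiff ℝ 1 γ ∧ (∀ t, deriv γ t ≠ 0) ∧ (∀ t, γ (t + 1) = γ t) ∧ (∀ t, γ t ∈ M.carrier) ∧
    Continuous φ ∧ StrictMono φ ∧ (∀ t, φ (t + 1) = φ t + 1) ∧
    ∀ ε > 0, ∀ᶠ k in atTop, ∀ j : ℤ,
      M.gdist (P k j) (γ (φ ((j : ℝ) / (N * 2 ^ k)))) < ε

end Polygon

end AngleSubdivision

end

/-!
A predictor cannot make the angle features `O(h)` without choosing small angles: inserting with the
angle `α` on the edge `p q` creates an exterior angle `2 α + O(h)` at the new vertex, and that angle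
is a feature of the next polygon. Hence the insertion angles are `O(h)`; so are those of the
four-point scheme, being averages of exterior angles, and two insertions with angles `O(h)` on an
edge of length at most `h` differ by `O(h ^ 2)`.

Insertion with an angle `O(h)` replaces an edge `e` by two edges of length at most
`(e / 2) * (1 + O(h))`. Therefore `h k` is eventually almost halved, which makes it summable, and
then the product of the correction factors converges, so that `h k = O(2 ^ (-k))`. In the ambient
normed space the chords and the turning between consecutive chords decay at the same rate. The
chord directions, as functions of the dyadic parameter, converge uniformly to a continuous unit
tangent, the cumulative lengths converge to the arc length, and the limit curve parametrized
proportionally to arc length is `C¹` with nonzero derivative.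
-/

noncomputable section

namespace AngleSubdivision

open Filter Topology ComplexConjugate NormedSpace

section IntegerSequences

/-- The primitive of `e : ℤ → G` for the forward difference, vanishing at `0`; it accumulates the
edge lengths of a polygon indexed by `ℤ`. -/
def primitive {G : Type*} [AddCommGroup G] (e : ℤ → G) (j : ℤ) : G :=
  ∑ i ∈ Finset.Ico 0 j, e i - ∑ i ∈ Finset.Ico j 0, e i

lemma primitive_zero {G : Type*} [AddCommGroup G] (e : ℤ → G) : primitive e 0 = 0 := by
  simp [primitive]

lemma primitive_add_one {G : Type*} [AddCommGroup G] (e : ℤ → G) (j : ℤ) :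
    primitive e (j + 1) = primitive e j + e j := by
  rcases le_or_gt 0 j with hj | hj
  · rw [primitive, primitive, ← Finset.insert_Ico_right_eq_Ico_add_one hj,
      Finset.sum_insert Finset.right_notMem_Ico, Finset.Ico_eq_empty_of_le hj,
      Finset.Ico_eq_empty_of_le (hj.trans (Int.le_add_one le_rfl))]
    abel
  · rw [primitive, primitive, ← Finset.insert_Ico_add_one_left_eq_Ico hj,
      Finset.sum_insert (by simp), Finset.Ico_eq_empty_of_le hj.le,
      Finset.Ico_eq_empty_of_le (Int.add_one_le_of_lt hj)]
    abel

lemma eq_zero_of_forall_add_one_eq {α : Type*} {f : ℤ → α} (hf : ∀ j, f (j + 1) = f j) (j : ℤ) :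
    f j = f 0 := by
  simpa using (show Function.Periodic f 1 from hf).int_mul_eq j

lemma primitive_add_period {G : Type*} [AddCommGroup G] {e : ℤ → G} {n : ℤ}
    (he : Function.Periodic e n) (j : ℤ) :
    primitive e (j + n) = primitive e j + primitive e n := by
  have hconst := eq_zero_of_forall_add_one_eq (f := fun j => primitive e (j + n) - primitive e j)
    (fun j => by rw [add_right_comm, primitive_add_one, primitive_add_one, he j]; abel) j
  simpa [primitive_zero, sub_eq_iff_eq_add'] using hconst

lemma dist_le_mul_abs_sub {E : Type*} [PseudoMetricSpace E] {f : ℤ → E} {b : ℝ}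
    (hf : ∀ j, dist (f j) (f (j + 1)) ≤ b) (i j : ℤ) : dist (f i) (f j) ≤ b * |(i : ℝ) - j| := by
  wlog hij : i ≤ j generalizing i j
  · rw [dist_comm, abs_sub_comm]
    exact this j i (not_le.1 hij).le
  induction j, hij using Int.leInduction with
  | base => simp
  | succ j hij ih =>
    have hij' : (i : ℝ) ≤ j := Int.cast_le.2 hij
    rw [abs_sub_comm, abs_of_nonneg (sub_nonneg.2 hij')] at ih
    rw [Int.cast_add, Int.cast_one, abs_sub_comm, abs_of_nonneg (by linarith)]
    linarith [dist_triangle (f i) (f j) (f (j + 1)), hf j]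

end IntegerSequences

section Chords

variable {V : Type*} [NormedAddCommGroup V] [NormedSpace ℝ V]

lemma norm_normalize_le_one (v : V) : ‖normalize v‖ ≤ 1 := by
  rcases eq_or_ne v 0 with rfl | hv
  · simp
  · exact (norm_normalize_eq_one_iff.2 hv).le

lemma norm_mul_norm_normalize_sub_le (v w : V) :
    ‖v‖ * ‖normalize v - normalize w‖ ≤ 2 * ‖v - w‖ := by
  have hsplit : ‖v‖ • (normalize v - normalize w) = (v - w) + (‖w‖ - ‖v‖) • normalize w := by
    rw [smul_sub, norm_smul_normalize, sub_smul, norm_smul_normalize]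
    abel
  have hnorm : |‖w‖ - ‖v‖| * ‖normalize w‖ ≤ ‖v - w‖ := by
    rw [norm_sub_rev v w]
    exact (mul_le_of_le_one_right (abs_nonneg _) (norm_normalize_le_one w)).trans
      (abs_norm_sub_norm_le w v)
  calc ‖v‖ * ‖normalize v - normalize w‖ = ‖(v - w) + (‖w‖ - ‖v‖) • normalize w‖ := by
        rw [← hsplit, norm_smul, norm_norm]
    _ ≤ ‖v - w‖ + |‖w‖ - ‖v‖| * ‖normalize w‖ := by
        rw [← Real.norm_eq_abs, ← norm_smul]; exact norm_add_le _ _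
    _ ≤ 2 * ‖v - w‖ := by linarith

/-- The unit vector of the chord from `p` to `q` in the ambient normed space (`0` if `p = q`), with
which the three kinds of geodesic directions are compared. -/
def chordDir (p q : V) : V := normalize (q - p)

lemma norm_chordDir {p q : V} (h : p ≠ q) : ‖chordDir p q‖ = 1 :=
  norm_normalize_eq_one_iff.2 (sub_ne_zero.2 h.symm)

lemma norm_smul_chordDir (p q : V) : ‖q - p‖ • chordDir p q = q - p :=
  norm_smul_normalize _

lemma chordDir_comm (p q : V) : chordDir q p = -chordDir p q := by
  rw [chordDir, chordDir, ← normalize_neg, neg_sub]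

lemma norm_add_smul_chordDir_sub (a b c : V) :
    ‖(‖b - a‖ + ‖c - b‖) • chordDir a b - (c - a)‖ =
      ‖c - b‖ * ‖chordDir b c - chordDir a b‖ := by
  have hvec : (‖b - a‖ + ‖c - b‖) • chordDir a b - (c - a) =
      ‖c - b‖ • (chordDir a b - chordDir b c) := by
    rw [add_smul, norm_smul_chordDir, smul_sub, norm_smul_chordDir]
    abel
  rw [hvec, norm_smul, norm_norm, norm_sub_rev (chordDir a b)]

lemma norm_norm_add_norm_smul_chordDir {a b : V} (hab : a ≠ b) (c : V) :
    ‖(‖b - a‖ + ‖c - b‖) • chordDir a b‖ = ‖b - a‖ + ‖c - b‖ := by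
  rw [norm_smul, norm_chordDir hab, mul_one, Real.norm_of_nonneg (by positivity)]

lemma norm_chordDir_sub_chordDir_le {a b : V} (hab : a ≠ b) (c : V) :
    ‖chordDir a b - chordDir a c‖ ≤ 2 * ‖chordDir b c - chordDir a b‖ := by
  have hpos : 0 < ‖b - a‖ + ‖c - b‖ :=
    add_pos_of_pos_of_nonneg (norm_pos_iff.2 (sub_ne_zero.2 hab.symm)) (norm_nonneg _)
  have hdir : normalize ((‖b - a‖ + ‖c - b‖) • chordDir a b) = chordDir a b := by
    rw [normalize_smul_of_pos hpos, normalize_eq_self_of_norm_eq_one (norm_chordDir hab)]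
  have hkey := norm_mul_norm_normalize_sub_le ((‖b - a‖ + ‖c - b‖) • chordDir a b) (c - a)
  rw [hdir, norm_add_smul_chordDir_sub, norm_norm_add_norm_smul_chordDir hab] at hkey
  refine le_of_mul_le_mul_left (hkey.trans ?_) hpos
  nlinarith [mul_nonneg (norm_nonneg (b - a)) (norm_nonneg (chordDir b c - chordDir a b))]

lemma norm_sub_add_norm_sub_le {a b : V} (hab : a ≠ b) (c : V) :
    ‖b - a‖ + ‖c - b‖ ≤ ‖c - a‖ + ‖c - b‖ * ‖chordDir b c - chordDir a b‖ := by
  have hnorm := norm_sub_norm_le ((‖b - a‖ + ‖c - b‖) • chordDir a b) (c - a)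
  rw [norm_norm_add_norm_smul_chordDir hab, norm_add_smul_chordDir_sub] at hnorm
  linarith

end Chords

section DyadicIndices

/-- The index of the last vertex with dyadic parameter at most `t`, when the vertex `j` of a polygon
with `N * 2 ^ k` vertices has the parameter `j / (N * 2 ^ k)`. -/
def dyadicIdx (N k : ℕ) (t : ℝ) : ℤ := ⌊t * (N * 2 ^ k)⌋

lemma dyadicIdx_succ (N k : ℕ) (t : ℝ) :
    dyadicIdx N (k + 1) t = 2 * dyadicIdx N k t ∨
      dyadicIdx N (k + 1) t = 2 * dyadicIdx N k t + 1 := by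
  have hdouble : t * (N * 2 ^ (k + 1)) = 2 * (t * (N * 2 ^ k)) := by ring
  have hle : 2 * ⌊t * (N * 2 ^ k)⌋ ≤ ⌊t * (N * 2 ^ (k + 1))⌋ := by
    rw [Int.le_floor, hdouble]
    push_cast
    linarith [Int.floor_le (t * (N * 2 ^ k))]
  have hlt : ⌊t * (N * 2 ^ (k + 1))⌋ < 2 * ⌊t * (N * 2 ^ k)⌋ + 2 := by
    rw [Int.floor_lt, hdouble]
    push_cast
    linarith [Int.lt_floor_add_one (t * (N * 2 ^ k))]
  unfold dyadicIdx
  omega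

lemma dyadicIdx_mono {N k : ℕ} {t u : ℝ} (h : t ≤ u) : dyadicIdx N k t ≤ dyadicIdx N k u :=
  Int.floor_le_floor (by gcongr)

lemma dyadicIdx_zero (N k : ℕ) : dyadicIdx N k 0 = 0 := by simp [dyadicIdx]

lemma dyadicIdx_add_one (N k : ℕ) (t : ℝ) :
    dyadicIdx N k (t + 1) = dyadicIdx N k t + (N * 2 ^ k : ℕ) := by
  rw [dyadicIdx, dyadicIdx, ← Int.floor_add_natCast]
  congr 1
  push_cast
  ring

lemma dyadicIdx_dyadic {N : ℕ} (hN : 0 < N) (k m : ℕ) (j : ℤ) :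
    dyadicIdx N (k + m) ((j : ℝ) / (N * 2 ^ k)) = 2 ^ m * j := by
  have hN' : (N : ℝ) ≠ 0 := by positivity
  have hcast : (j : ℝ) / (N * 2 ^ k) * (N * 2 ^ (k + m)) = ((2 ^ m * j : ℤ) : ℝ) := by
    push_cast
    field_simp
    ring
  rw [dyadicIdx, hcast, Int.floor_intCast]

lemma abs_dyadicIdx_sub_le (N k : ℕ) (t u : ℝ) :
    |(dyadicIdx N k t : ℝ) - dyadicIdx N k u| ≤ N * 2 ^ k * |t - u| + 1 := by
  have hscale : |t * (N * 2 ^ k) - u * (N * 2 ^ k)| = N * 2 ^ k * |t - u| := by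
    rw [← sub_mul, abs_mul, abs_of_nonneg (by positivity : (0 : ℝ) ≤ N * 2 ^ k), mul_comm]
  have ht := Int.floor_le (t * (N * 2 ^ k))
  have ht' := Int.lt_floor_add_one (t * (N * 2 ^ k))
  have hu := Int.floor_le (u * (N * 2 ^ k))
  have hu' := Int.lt_floor_add_one (u * (N * 2 ^ k))
  have hdiff := abs_le.1 (le_refl |t * (N * 2 ^ k) - u * (N * 2 ^ k)|)
  rw [← hscale, dyadicIdx, dyadicIdx, abs_le]
  constructor <;> linarith

lemma half_pow_mul_two_pow (k : ℕ) : (1 / 2 : ℝ) ^ k * 2 ^ k = 1 := by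
  rw [← mul_pow]
  norm_num

lemma half_pow_mul_abs_dyadicIdx_le (N k : ℕ) (t : ℝ) :
    (1 / 2 : ℝ) ^ k * |(dyadicIdx N k t : ℝ)| ≤ N * |t| + 1 := by
  have hidx : |(dyadicIdx N k t : ℝ)| ≤ N * 2 ^ k * |t| + 1 := by
    simpa [dyadicIdx_zero] using abs_dyadicIdx_sub_le N k t 0
  have hpow : (1 / 2 : ℝ) ^ k ≤ 1 := pow_le_one₀ (by norm_num) (by norm_num)
  calc (1 / 2 : ℝ) ^ k * |(dyadicIdx N k t : ℝ)|
      ≤ (1 / 2 : ℝ) ^ k * (N * 2 ^ k * |t| + 1) := by gcongr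
    _ = N * |t| * ((1 / 2 : ℝ) ^ k * 2 ^ k) + (1 / 2 : ℝ) ^ k := by ring
    _ ≤ N * |t| + 1 := by rw [half_pow_mul_two_pow]; linarith

lemma tendsto_half_pow_mul_index_bound (N : ℕ) (A t u : ℝ) :
    Tendsto (fun k : ℕ => A * (1 / 2) ^ k * (N * 2 ^ k * |t - u| + 1)) atTop
      (𝓝 (A * N * |t - u|)) := by
  have hlim : Tendsto (fun k : ℕ => A * N * |t - u| + A * (1 / 2 : ℝ) ^ k) atTop
      (𝓝 (A * N * |t - u| + A * 0)) :=
    tendsto_const_nhds.add ((tendsto_pow_atTop_nhds_zero_of_lt_one (by norm_num)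
      (by norm_num)).const_mul A)
  rw [mul_zero, add_zero] at hlim
  exact hlim.congr fun k => by
    linear_combination -A * N * |t - u| * half_pow_mul_two_pow k

lemma exists_dyadic_between {N : ℕ} (hN : 0 < N) {t u : ℝ} (h : t < u) :
    ∃ (k : ℕ) (j : ℤ), t ≤ (j : ℝ) / (N * 2 ^ k) ∧ ((j + 1 : ℤ) : ℝ) / (N * 2 ^ k) ≤ u := by
  have hgap : 0 < u - t := sub_pos.2 h
  obtain ⟨k, hk⟩ := pow_unbounded_of_one_lt (2 / (u - t)) (by norm_num : (1 : ℝ) < 2)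
  have hpos : (0 : ℝ) < N * 2 ^ k := by positivity
  have hfine : 2 < N * 2 ^ k * (u - t) := by
    rw [div_lt_iff₀ hgap] at hk
    have hN' : (1 : ℝ) ≤ N := by exact_mod_cast hN
    rw [mul_assoc]
    exact hk.trans_le (le_mul_of_one_le_left (by positivity) hN')
  refine ⟨k, ⌈t * (N * 2 ^ k)⌉, (le_div_iff₀ hpos).2 (Int.le_ceil _), ?_⟩
  rw [div_le_iff₀ hpos]
  push_cast
  linarith [Int.ceil_lt_add_one (t * (N * 2 ^ k))]

lemma dist_dyadicIdx_succ_le {E : Type*} [PseudoMetricSpace E] {x : ℕ → ℤ → E} {N k : ℕ} {t : ℝ}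
    {b c : ℝ} (heven : dist (x k (dyadicIdx N k t)) (x (k + 1) (2 * dyadicIdx N k t)) ≤ b)
    (hodd : dist (x (k + 1) (2 * dyadicIdx N k t)) (x (k + 1) (2 * dyadicIdx N k t + 1)) ≤ c) :
    dist (x k (dyadicIdx N k t)) (x (k + 1) (dyadicIdx N (k + 1) t)) ≤ b + c := by
  rcases dyadicIdx_succ N k t with h | h <;> rw [h]
  · linarith [dist_nonneg.trans hodd]
  · exact (dist_triangle _ _ _).trans (add_le_add heven hodd)

/-- The limit along the vertices whose dyadic parameters approach `t` from below, for data `x k j`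
attached to the vertices of successively refined polygons. -/
def dyadicLimit {E : Type*} [TopologicalSpace E] [Nonempty E] (N : ℕ) (x : ℕ → ℤ → E) (t : ℝ) : E :=
  limUnder atTop fun k => x k (dyadicIdx N k t)

lemma tendsto_dyadicLimit {E : Type*} [PseudoMetricSpace E] [CompleteSpace E] [Nonempty E]
    {x : ℕ → ℤ → E} {N : ℕ} {t C : ℝ}
    (hx : ∀ k, dist (x k (dyadicIdx N k t)) (x (k + 1) (dyadicIdx N (k + 1) t)) ≤
      C * (1 / 2) ^ k) :
    Tendsto (fun k => x k (dyadicIdx N k t)) atTop (𝓝 (dyadicLimit N x t)) :=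
  (cauchySeq_of_le_geometric (1 / 2) C (by norm_num) hx).tendsto_limUnder

lemma dist_le_of_tendsto_dyadicIdx {E : Type*} [PseudoMetricSpace E] {x : ℕ → ℤ → E} {N : ℕ}
    {A t u : ℝ} {X Y : E} (hx : ∀ k j, dist (x k j) (x k (j + 1)) ≤ A * (1 / 2) ^ k)
    (hX : Tendsto (fun k => x k (dyadicIdx N k t)) atTop (𝓝 X))
    (hY : Tendsto (fun k => x k (dyadicIdx N k u)) atTop (𝓝 Y)) :
    dist X Y ≤ A * N * |t - u| := by
  refine le_of_tendsto_of_tendsto' (hX.dist hY) (tendsto_half_pow_mul_index_bound N A t u)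
    fun k => (dist_le_mul_abs_sub (hx k) _ _).trans ?_
  exact mul_le_mul_of_nonneg_left (abs_dyadicIdx_sub_le N k t u) (dist_nonneg.trans (hx k 0))

end DyadicIndices

section RefiningPolygons

variable {V : Type*} [NormedAddCommGroup V]

/-- The signed length of the polygon `p` from its vertex `0` to its vertex `j`. -/
def cumLength (p : ℤ → V) : ℤ → ℝ := primitive fun i => ‖p (i + 1) - p i‖

lemma cumLength_zero (p : ℤ → V) : cumLength p 0 = 0 := primitive_zero _

lemma cumLength_add_one (p : ℤ → V) (j : ℤ) :
    cumLength p (j + 1) = cumLength p j + ‖p (j + 1) - p j‖ :=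
  primitive_add_one _ _

lemma dist_cumLength_add_one (p : ℤ → V) (j : ℤ) :
    dist (cumLength p j) (cumLength p (j + 1)) = dist (p j) (p (j + 1)) := by
  rw [cumLength_add_one, dist_self_add_right, norm_norm, dist_eq_norm']

lemma norm_sub_le_cumLength_sub (p : ℤ → V) {i j : ℤ} (h : i ≤ j) :
    ‖p j - p i‖ ≤ cumLength p j - cumLength p i := by
  induction j, h using Int.leInduction with
  | base => simp
  | succ j _ ih =>
    rw [cumLength_add_one]
    linarith [norm_sub_le_norm_sub_add_norm_sub (p (j + 1)) (p j) (p i)]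

lemma cumLength_add_period {p : ℤ → V} {n : ℤ} (hp : Function.Periodic p n) (j : ℤ) :
    cumLength p (j + n) = cumLength p j + cumLength p n :=
  primitive_add_period (fun i => by rw [add_right_comm, hp, hp]) j

variable [NormedSpace ℝ V]

/-- The unit direction of the edge `j` of the polygon `p`. -/
def edgeDir (p : ℤ → V) (j : ℤ) : V := chordDir (p j) (p (j + 1))

lemma norm_edgeDir {p : ℤ → V} {j : ℤ} (h : p j ≠ p (j + 1)) : ‖edgeDir p j‖ = 1 :=
  norm_chordDir h

lemma norm_sub_sub_cumLength_smul_edgeDir_le {p : ℤ → V} {b : ℝ}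
    (hturn : ∀ j, dist (edgeDir p j) (edgeDir p (j + 1)) ≤ b) {i j : ℤ} (hij : i ≤ j) :
    ‖p j - p i - (cumLength p j - cumLength p i) • edgeDir p i‖ ≤
      (cumLength p j - cumLength p i) * (b * (j - i)) := by
  have hb : 0 ≤ b := dist_nonneg.trans (hturn 0)
  induction j, hij using Int.leInduction with
  | base => simp
  | succ j hij ih =>
    have hij' : (i : ℝ) ≤ j := Int.cast_le.2 hij
    have hdir : ‖edgeDir p j - edgeDir p i‖ ≤ b * (j - i) := by
      simpa [dist_eq_norm, abs_of_nonneg (sub_nonneg.2 hij')] using dist_le_mul_abs_sub hturn j i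
    have hlength : 0 ≤ cumLength p j - cumLength p i :=
      (norm_nonneg _).trans (norm_sub_le_cumLength_sub p hij)
    have hsplit : p (j + 1) - p i - (cumLength p (j + 1) - cumLength p i) • edgeDir p i =
        (p j - p i - (cumLength p j - cumLength p i) • edgeDir p i) +
          ‖p (j + 1) - p j‖ • (edgeDir p j - edgeDir p i) := by
      rw [cumLength_add_one, smul_sub, edgeDir, edgeDir, norm_smul_chordDir, add_sub_right_comm,
        add_smul]
      abel
    calc ‖p (j + 1) - p i - (cumLength p (j + 1) - cumLength p i) • edgeDir p i‖
        ≤ (cumLength p j - cumLength p i) * (b * (j - i)) +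
          ‖p (j + 1) - p j‖ * (b * (j - i)) := by
          rw [hsplit]
          refine (norm_add_le _ _).trans (add_le_add ih ?_)
          rw [norm_smul, norm_norm]
          gcongr
      _ = (cumLength p (j + 1) - cumLength p i) * (b * (j - i)) := by
          rw [cumLength_add_one]; ring
      _ ≤ (cumLength p (j + 1) - cumLength p i) * (b * ((j + 1 : ℤ) - i)) := by
          have hlength' := (norm_nonneg _).trans
            (norm_sub_le_cumLength_sub p (hij.trans (Int.le_add_one le_rfl)))
          push_cast
          gcongr
          linarith

/-- Closed polygons `P k` with `N * 2 ^ k` vertices, each refining the previous one by vertex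
insertion, whose chords and turnings decay like `2 ^ (-k)`. -/
structure IsRefining (N : ℕ) (P : ℕ → ℤ → V) (A : ℝ) : Prop where
  pos : 0 < N
  periodic : ∀ k, Function.Periodic (P k) (N * 2 ^ k : ℕ)
  even : ∀ k j, P (k + 1) (2 * j) = P k j
  ne : ∀ k j, P k j ≠ P k (j + 1)
  dist_le : ∀ k j, dist (P k j) (P k (j + 1)) ≤ A * (1 / 2) ^ k
  dist_edgeDir_le : ∀ k j, dist (edgeDir (P k) j) (edgeDir (P k) (j + 1)) ≤ A * (1 / 2) ^ k

namespace IsRefining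

variable {N : ℕ} {P : ℕ → ℤ → V} {A : ℝ}

lemma nonneg (h : IsRefining N P A) : 0 ≤ A := by
  simpa using dist_nonneg.trans (h.dist_le 0 0)

lemma apply_pow_mul (h : IsRefining N P A) (k m : ℕ) (j : ℤ) : P (k + m) (2 ^ m * j) = P k j := by
  induction m with
  | zero => simp
  | succ m ih => rw [← add_assoc, pow_succ', mul_assoc, h.even, ih]

lemma even_add_one_add_one (h : IsRefining N P A) (k : ℕ) (j : ℤ) :
    P (k + 1) (2 * j + 1 + 1) = P k (j + 1) := by
  rw [← h.even k (j + 1)]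
  ring_nf

lemma dist_cumLength_le (h : IsRefining N P A) (k : ℕ) (j : ℤ) :
    dist (cumLength (P k) j) (cumLength (P k) (j + 1)) ≤ A * (1 / 2) ^ k :=
  (dist_cumLength_add_one _ _).trans_le (h.dist_le k j)

lemma dist_edgeDir_even_le (h : IsRefining N P A) (k : ℕ) (j : ℤ) :
    dist (edgeDir (P k) j) (edgeDir (P (k + 1)) (2 * j)) ≤ A * (1 / 2) ^ k := by
  have hchord := norm_chordDir_sub_chordDir_le (h.ne (k + 1) (2 * j)) (P (k + 1) (2 * j + 1 + 1))
  have hturn := h.dist_edgeDir_le (k + 1) (2 * j)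
  rw [dist_comm, dist_eq_norm, edgeDir, edgeDir, pow_succ] at hturn
  rw [dist_comm, dist_eq_norm, edgeDir, edgeDir, ← h.even_add_one_add_one k j, ← h.even k j]
  linarith

lemma norm_mul_turn_le (h : IsRefining N P A) (k : ℕ) (j : ℤ) :
    ‖P k (j + 1 + 1) - P k (j + 1)‖ *
        ‖chordDir (P k (j + 1)) (P k (j + 1 + 1)) - chordDir (P k j) (P k (j + 1))‖ ≤
      A ^ 2 * (1 / 4) ^ k := by
  have hchord := h.dist_le k (j + 1)
  have hturn := h.dist_edgeDir_le k j
  have hquarter : (1 / 4 : ℝ) ^ k = (1 / 2) ^ k * (1 / 2) ^ k := by rw [← mul_pow]; norm_num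
  rw [dist_eq_norm'] at hchord hturn
  calc _ ≤ A * (1 / 2) ^ k * (A * (1 / 2) ^ k) :=
        mul_le_mul hchord hturn (norm_nonneg _) ((norm_nonneg _).trans hchord)
    _ = A ^ 2 * (1 / 4) ^ k := by rw [hquarter]; ring

lemma abs_cumLength_even_sub_le (h : IsRefining N P A) (k : ℕ) (j : ℤ) :
    |cumLength (P (k + 1)) (2 * j) - cumLength (P k) j| ≤ A ^ 2 * (1 / 4) ^ k * |(j : ℝ)| := by
  have hstep (j : ℤ) : dist (cumLength (P (k + 1)) (2 * j) - cumLength (P k) j)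
      (cumLength (P (k + 1)) (2 * (j + 1)) - cumLength (P k) (j + 1)) ≤ A ^ 2 * (1 / 4) ^ k := by
    have hlower := norm_sub_add_norm_sub_le (h.ne (k + 1) (2 * j)) (P (k + 1) (2 * j + 1 + 1))
    have hupper := norm_sub_le_norm_sub_add_norm_sub (P (k + 1) (2 * j + 1 + 1))
      (P (k + 1) (2 * j + 1)) (P (k + 1) (2 * j))
    have hturn := h.norm_mul_turn_le (k + 1) (2 * j)
    have hpow : 0 ≤ A ^ 2 * (1 / 4 : ℝ) ^ k := by positivity
    rw [pow_succ (1 / 4 : ℝ)] at hturn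
    rw [show 2 * (j + 1) = 2 * j + 1 + 1 by ring, cumLength_add_one, cumLength_add_one,
      cumLength_add_one, ← h.even_add_one_add_one k j, ← h.even k j, dist_comm, Real.dist_eq,
      abs_le]
    constructor <;> linarith
  simpa [dist_eq_norm, cumLength_zero] using dist_le_mul_abs_sub hstep j 0

end IsRefining

/-- The position at the dyadic parameter `t` of the limit of the polygons `P k`. -/
def limitVertex (N : ℕ) (P : ℕ → ℤ → V) : ℝ → V := dyadicLimit N P

/-- The unit tangent at the dyadic parameter `t` of the limit of the polygons `P k`. -/
def limitDir (N : ℕ) (P : ℕ → ℤ → V) : ℝ → V := dyadicLimit N fun k => edgeDir (P k)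

/-- The arc length at the dyadic parameter `t` of the limit of the polygons `P k`. -/
def limitLength (N : ℕ) (P : ℕ → ℤ → V) : ℝ → ℝ := dyadicLimit N fun k => cumLength (P k)

namespace IsRefining

variable {N : ℕ} {P : ℕ → ℤ → V} {A : ℝ}

lemma tendsto_limitVertex [CompleteSpace V] (h : IsRefining N P A) (t : ℝ) :
    Tendsto (fun k => P k (dyadicIdx N k t)) atTop (𝓝 (limitVertex N P t)) := by
  refine tendsto_dyadicLimit (C := A) fun k => ?_
  have hodd := h.dist_le (k + 1) (2 * dyadicIdx N k t)
  refine (dist_dyadicIdx_succ_le (x := P) (by rw [h.even, dist_self]) hodd).trans ?_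
  have hpow : 0 ≤ A * (1 / 2) ^ k := mul_nonneg h.nonneg (by positivity)
  rw [pow_succ]
  linarith

lemma tendsto_limitDir [CompleteSpace V] (h : IsRefining N P A) (t : ℝ) :
    Tendsto (fun k => edgeDir (P k) (dyadicIdx N k t)) atTop (𝓝 (limitDir N P t)) := by
  refine tendsto_dyadicLimit (C := 2 * A) (x := fun k => edgeDir (P k)) fun k => ?_
  have hodd := h.dist_edgeDir_le (k + 1) (2 * dyadicIdx N k t)
  refine (dist_dyadicIdx_succ_le (x := fun k => edgeDir (P k)) (h.dist_edgeDir_even_le k _)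
    hodd).trans ?_
  have hpow : 0 ≤ A * (1 / 2) ^ k := mul_nonneg h.nonneg (by positivity)
  rw [pow_succ]
  linarith

lemma tendsto_limitLength (h : IsRefining N P A) (t : ℝ) :
    Tendsto (fun k => cumLength (P k) (dyadicIdx N k t)) atTop (𝓝 (limitLength N P t)) := by
  refine tendsto_dyadicLimit (C := A ^ 2 * (N * |t| + 1) + A) (x := fun k => cumLength (P k))
    fun k => ?_
  have heven : dist (cumLength (P k) (dyadicIdx N k t))
      (cumLength (P (k + 1)) (2 * dyadicIdx N k t)) ≤ A ^ 2 * (N * |t| + 1) * (1 / 2) ^ k := by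
    have hquarter : (1 / 4 : ℝ) ^ k = (1 / 2) ^ k * (1 / 2) ^ k := by rw [← mul_pow]; norm_num
    calc _ ≤ A ^ 2 * (1 / 4) ^ k * |(dyadicIdx N k t : ℝ)| := by
          rw [dist_comm, Real.dist_eq]; exact h.abs_cumLength_even_sub_le k _
      _ = A ^ 2 * ((1 / 2 : ℝ) ^ k * |(dyadicIdx N k t : ℝ)|) * (1 / 2) ^ k := by
          rw [hquarter]; ring
      _ ≤ A ^ 2 * (N * |t| + 1) * (1 / 2) ^ k := by
          gcongr
          exact half_pow_mul_abs_dyadicIdx_le N k t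
  refine (dist_dyadicIdx_succ_le (x := fun k => cumLength (P k)) heven
    (h.dist_cumLength_le (k + 1) _)).trans ?_
  have hpow : 0 ≤ A * (1 / 2) ^ k := mul_nonneg h.nonneg (by positivity)
  rw [pow_succ (1 / 2 : ℝ)]
  linarith

lemma dist_limitLength_le (h : IsRefining N P A) (t u : ℝ) :
    dist (limitLength N P t) (limitLength N P u) ≤ A * N * |t - u| :=
  dist_le_of_tendsto_dyadicIdx (x := fun k => cumLength (P k)) h.dist_cumLength_le
    (h.tendsto_limitLength t) (h.tendsto_limitLength u)

lemma continuous_limitLength (h : IsRefining N P A) : Continuous (limitLength N P) :=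
  (LipschitzWith.of_dist_le' h.dist_limitLength_le).continuous

lemma limitLength_add_one (h : IsRefining N P A) (t : ℝ) :
    limitLength N P (t + 1) = limitLength N P t + limitLength N P 1 := by
  refine tendsto_nhds_unique (h.tendsto_limitLength (t + 1))
    (((h.tendsto_limitLength t).add (h.tendsto_limitLength 1)).congr fun k => ?_)
  have hone : dyadicIdx N k 1 = (N * 2 ^ k : ℕ) := by
    simpa [dyadicIdx_zero] using dyadicIdx_add_one N k 0
  rw [dyadicIdx_add_one, hone, cumLength_add_period (h.periodic k)]

variable [CompleteSpace V]

lemma limitVertex_dyadic (h : IsRefining N P A) (k : ℕ) (j : ℤ) :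
    limitVertex N P ((j : ℝ) / (N * 2 ^ k)) = P k j := by
  refine tendsto_nhds_unique (h.tendsto_limitVertex _)
    (tendsto_atTop_of_eventually_const (i₀ := k) fun m hm => ?_)
  obtain ⟨m, rfl⟩ := Nat.exists_eq_add_of_le hm
  rw [dyadicIdx_dyadic h.pos, h.apply_pow_mul]

lemma limitVertex_add_one (h : IsRefining N P A) (t : ℝ) :
    limitVertex N P (t + 1) = limitVertex N P t := by
  refine tendsto_nhds_unique (h.tendsto_limitVertex (t + 1))
    ((h.tendsto_limitVertex t).congr fun k => ?_)
  rw [dyadicIdx_add_one, h.periodic]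

lemma limitVertex_mem_closure (h : IsRefining N P A) (t : ℝ) :
    limitVertex N P t ∈ closure {x | ∃ k j, P k j = x} :=
  mem_closure_of_tendsto (h.tendsto_limitVertex t) (Eventually.of_forall fun k => ⟨k, _, rfl⟩)

lemma norm_limitDir (h : IsRefining N P A) (t : ℝ) : ‖limitDir N P t‖ = 1 :=
  tendsto_nhds_unique (h.tendsto_limitDir t).norm
    (tendsto_const_nhds.congr fun k => (norm_edgeDir (h.ne k _)).symm)

lemma dist_limitDir_le (h : IsRefining N P A) (t u : ℝ) :
    dist (limitDir N P t) (limitDir N P u) ≤ A * N * |t - u| :=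
  dist_le_of_tendsto_dyadicIdx (x := fun k => edgeDir (P k)) h.dist_edgeDir_le
    (h.tendsto_limitDir t) (h.tendsto_limitDir u)

lemma continuous_limitDir (h : IsRefining N P A) : Continuous (limitDir N P) :=
  (LipschitzWith.of_dist_le' h.dist_limitDir_le).continuous

lemma norm_limitVertex_sub_le (h : IsRefining N P A) {t u : ℝ} (htu : t ≤ u) :
    ‖limitVertex N P u - limitVertex N P t‖ ≤ limitLength N P u - limitLength N P t :=
  le_of_tendsto_of_tendsto' ((h.tendsto_limitVertex u).sub (h.tendsto_limitVertex t)).norm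
    ((h.tendsto_limitLength u).sub (h.tendsto_limitLength t))
    fun k => norm_sub_le_cumLength_sub (P k) (dyadicIdx_mono htu)

lemma limitLength_monotone (h : IsRefining N P A) : Monotone (limitLength N P) := fun _ _ htu =>
  sub_nonneg.1 ((norm_nonneg _).trans (h.norm_limitVertex_sub_le htu))

-- Between any two parameters lies a whole edge of some polygon, and its chord is not zero.
lemma limitLength_strictMono (h : IsRefining N P A) : StrictMono (limitLength N P) := by
  intro t u htu
  obtain ⟨k, j, ht, hu⟩ := exists_dyadic_between h.pos htu
  have hle : ((j : ℤ) : ℝ) / (N * 2 ^ k) ≤ ((j + 1 : ℤ) : ℝ) / (N * 2 ^ k) := by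
    gcongr
    simp
  have hchord := h.norm_limitVertex_sub_le hle
  rw [h.limitVertex_dyadic, h.limitVertex_dyadic] at hchord
  have hpos : 0 < ‖P k (j + 1) - P k j‖ := norm_pos_iff.2 (sub_ne_zero.2 (h.ne k j).symm)
  linarith [h.limitLength_monotone ht, h.limitLength_monotone hu]

lemma norm_limitVertex_sub_sub_smul_le (h : IsRefining N P A) {t u : ℝ} (htu : t ≤ u) :
    ‖limitVertex N P u - limitVertex N P t -
        (limitLength N P u - limitLength N P t) • limitDir N P t‖ ≤
      (limitLength N P u - limitLength N P t) * (A * N * |u - t|) := by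
  have hlength := (h.tendsto_limitLength u).sub (h.tendsto_limitLength t)
  refine le_of_tendsto_of_tendsto' (((h.tendsto_limitVertex u).sub (h.tendsto_limitVertex t)).sub
    (hlength.smul (h.tendsto_limitDir t))).norm
    (hlength.mul (tendsto_half_pow_mul_index_bound N A u t)) fun k =>
      (norm_sub_sub_cumLength_smul_edgeDir_le (h.dist_edgeDir_le k) (dyadicIdx_mono htu)).trans ?_
  have hnonneg : 0 ≤ cumLength (P k) (dyadicIdx N k u) - cumLength (P k) (dyadicIdx N k t) :=
    (norm_nonneg _).trans (norm_sub_le_cumLength_sub (P k) (dyadicIdx_mono htu))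
  have hA := h.nonneg
  gcongr
  exact (le_abs_self _).trans (abs_dyadicIdx_sub_le N k u t)

lemma norm_limitVertex_sub_sub_smul_le_abs (h : IsRefining N P A) (t u : ℝ) :
    ‖limitVertex N P u - limitVertex N P t -
        (limitLength N P u - limitLength N P t) • limitDir N P t‖ ≤
      2 * (A * N) * |u - t| * |limitLength N P u - limitLength N P t| := by
  have hnonneg : 0 ≤ A * N * |u - t| :=
    mul_nonneg (mul_nonneg h.nonneg N.cast_nonneg) (abs_nonneg _)
  rcases le_total t u with htu | hut
  · have hmono := sub_nonneg.2 (h.limitLength_monotone htu)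
    rw [abs_of_nonneg hmono]
    refine (h.norm_limitVertex_sub_sub_smul_le htu).trans ?_
    linarith [mul_nonneg hmono hnonneg]
  · have hmono := sub_nonneg.2 (h.limitLength_monotone hut)
    have hback := h.norm_limitVertex_sub_sub_smul_le hut
    have hdir := h.dist_limitDir_le u t
    rw [dist_eq_norm] at hdir
    rw [abs_sub_comm t u] at hback
    have hswap : limitVertex N P u - limitVertex N P t -
          (limitLength N P u - limitLength N P t) • limitDir N P t =
        -(limitVertex N P t - limitVertex N P u -
          (limitLength N P t - limitLength N P u) • limitDir N P u) -
        (limitLength N P t - limitLength N P u) • (limitDir N P u - limitDir N P t) := by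
      rw [← neg_sub (limitLength N P t), neg_smul, smul_sub]
      abel
    rw [hswap, abs_sub_comm (limitLength N P u), abs_of_nonneg hmono]
    refine (norm_sub_le _ _).trans ?_
    rw [norm_neg, norm_smul, Real.norm_of_nonneg hmono]
    linarith [mul_le_mul_of_nonneg_left hdir hmono]

end IsRefining

lemma hasDerivAt_comp_orderIso_symm {F T : ℝ → V} (φ : ℝ ≃o ℝ) {C : ℝ}
    (hF : ∀ t u, ‖F u - F t - (φ u - φ t) • T t‖ ≤ C * |u - t| * |φ u - φ t|) (x : ℝ) :
    HasDerivAt (fun y => F (φ.symm y)) (T (φ.symm x)) x := by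
  have hbound : (fun y => F (φ.symm y) - F (φ.symm x) - (y - x) • T (φ.symm x)) =O[𝓝 x]
      fun y => (φ.symm y - φ.symm x) * (y - x) := by
    refine Asymptotics.IsBigO.of_bound C (Eventually.of_forall fun y => ?_)
    simpa [mul_assoc] using hF (φ.symm x) (φ.symm y)
  have hsmall : (fun y => φ.symm y - φ.symm x) =o[𝓝 x] fun _ => (1 : ℝ) := by
    rw [Asymptotics.isLittleO_one_iff]
    simpa using (φ.symm.continuous.tendsto x).sub_const (φ.symm x)
  rw [hasDerivAt_iff_isLittleO]
  refine hbound.trans_isLittleO ?_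
  simpa using hsmall.mul_isBigO (Asymptotics.isBigO_refl (fun y => y - x) (𝓝 x))

lemma surjective_of_map_add_one {φ : ℝ → ℝ} (hmono : Monotone φ) (hcont : Continuous φ)
    (hφ : ∀ t, φ (t + 1) = φ t + 1) : Function.Surjective φ :=
  (CircleDeg1Lift.continuous_iff_surjective ⟨⟨φ, hmono⟩, hφ⟩).1 hcont

namespace IsRefining

variable [CompleteSpace V] {N : ℕ} {P : ℕ → ℤ → V} {A : ℝ}

lemma limitLength_one_pos (h : IsRefining N P A) : 0 < limitLength N P 1 := by
  have hone := h.limitLength_add_one 0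
  rw [zero_add] at hone
  linarith [h.limitLength_strictMono zero_lt_one]

lemma exists_normalized_limitLength (h : IsRefining N P A) :
    ∃ φ : ℝ ≃o ℝ, (∀ t, φ (t + 1) = φ t + 1) ∧
      ∀ t, limitLength N P t = limitLength N P 1 * φ t := by
  have hpos := h.limitLength_one_pos
  have hmono : StrictMono fun t => limitLength N P t / limitLength N P 1 := fun t u htu =>
    div_lt_div_of_pos_right (h.limitLength_strictMono htu) hpos
  have hadd (t : ℝ) : limitLength N P (t + 1) / limitLength N P 1 =
      limitLength N P t / limitLength N P 1 + 1 := by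
    rw [h.limitLength_add_one, add_div, div_self hpos.ne']
  exact ⟨hmono.orderIsoOfSurjective _
    (surjective_of_map_add_one hmono.monotone (h.continuous_limitLength.div_const _) hadd), hadd,
    fun t => (mul_div_cancel₀ _ hpos.ne').symm⟩

lemma exists_curve (h : IsRefining N P A) : ∃ (γ : ℝ → V) (φ : ℝ → ℝ),
    ContDiff ℝ 1 γ ∧ (∀ t, deriv γ t ≠ 0) ∧ (∀ t, γ (t + 1) = γ t) ∧
    (∀ t, γ t ∈ closure {x | ∃ k j, P k j = x}) ∧
    Continuous φ ∧ StrictMono φ ∧ (∀ t, φ (t + 1) = φ t + 1) ∧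
    ∀ (k : ℕ) (j : ℤ), γ (φ ((j : ℝ) / (N * 2 ^ k))) = P k j := by
  obtain ⟨φ, hφ, hlength⟩ := h.exists_normalized_limitLength
  set L := limitLength N P 1
  have hpos : 0 < L := h.limitLength_one_pos
  have hderiv := hasDerivAt_comp_orderIso_symm (F := limitVertex N P)
    (T := fun t => L • limitDir N P t) φ (C := 2 * (A * N) * L) fun t u => by
      have hexp := h.norm_limitVertex_sub_sub_smul_le_abs t u
      rw [hlength, hlength, ← mul_sub, abs_mul, abs_of_pos hpos, mul_comm L (φ u - φ t),
        mul_smul] at hexp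
      linarith
  have hsymm (x : ℝ) : φ.symm (x + 1) = φ.symm x + 1 := by
    rw [OrderIso.symm_apply_eq, hφ, φ.apply_symm_apply]
  refine ⟨fun x => limitVertex N P (φ.symm x), φ, ?_, fun x => ?_, fun x => ?_,
    fun x => h.limitVertex_mem_closure _, φ.continuous, φ.strictMono, hφ, fun k j => ?_⟩
  · rw [contDiff_one_iff_deriv, funext fun x => (hderiv x).deriv]
    exact ⟨fun x => (hderiv x).differentiableAt,
      (h.continuous_limitDir.comp φ.symm.continuous).const_smul L⟩
  · rw [(hderiv x).deriv]
    exact smul_ne_zero hpos.ne' (norm_ne_zero_iff.1 (by simp [h.norm_limitDir]))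
  · simp only [hsymm, h.limitVertex_add_one]
  · simp only [φ.symm_apply_apply, h.limitVertex_dyadic]

end IsRefining

end RefiningPolygons

section RealSequences

lemma exists_forall_of_eventually {p : ℕ → ℝ → Prop} (hmono : ∀ k c c', c ≤ c' → p k c → p k c')
    (hp : ∀ k, ∃ c, p k c) (hev : ∃ c, ∀ᶠ k in atTop, p k c) : ∃ c, ∀ k, p k c := by
  choose c hc using hp
  obtain ⟨d, hd⟩ := hev
  obtain ⟨k₀, hk₀⟩ := eventually_atTop.1 hd
  obtain ⟨b, hb⟩ := ((Set.finite_Iio k₀).image c).bddAbove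
  refine ⟨max b d, fun k => ?_⟩
  rcases lt_or_ge k k₀ with hk | hk
  · exact hmono k _ _ ((hb ⟨k, hk, rfl⟩).trans (le_max_left b d)) (hc k)
  · exact hmono k _ _ (le_max_right b d) (hk₀ k hk)

lemma exists_forall_le_of_le_mul_one_add {a u : ℕ → ℝ} (ha : ∀ k, 0 ≤ a k) (hu : ∀ k, 0 ≤ u k)
    (hsum : Summable u) (hstep : ∀ᶠ k in atTop, a (k + 1) ≤ a k * (1 + u k)) :
    ∃ C, ∀ k, a k ≤ C := by
  obtain ⟨k₀, hk₀⟩ := eventually_atTop.1 hstep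
  have hexp (n : ℕ) : a (k₀ + n) ≤ a k₀ * Real.exp (∑ i ∈ Finset.range n, u (k₀ + i)) := by
    induction n with
    | zero => simp
    | succ n ih =>
      calc a (k₀ + n + 1) ≤ a (k₀ + n) * (1 + u (k₀ + n)) := hk₀ _ (Nat.le_add_right _ _)
        _ ≤ a k₀ * Real.exp (∑ i ∈ Finset.range n, u (k₀ + i)) * Real.exp (u (k₀ + n)) := by
          have hone := Real.add_one_le_exp (u (k₀ + n))
          have hpos := hu (k₀ + n)
          exact mul_le_mul ih (by linarith) (by linarith)
            (mul_nonneg (ha k₀) (Real.exp_pos _).le)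
        _ = a k₀ * Real.exp (∑ i ∈ Finset.range (n + 1), u (k₀ + i)) := by
          rw [Finset.sum_range_succ, Real.exp_add, mul_assoc]
  have hshift : Summable fun i => u (k₀ + i) := by
    simpa only [add_comm k₀] using (summable_nat_add_iff k₀).2 hsum
  refine exists_forall_of_eventually (fun _ _ _ hc h => h.trans hc) (fun k => ⟨a k, le_rfl⟩)
    ⟨a k₀ * Real.exp (∑' i, u (k₀ + i)), eventually_atTop.2 ⟨k₀, fun k hk => ?_⟩⟩
  obtain ⟨n, rfl⟩ := Nat.exists_eq_add_of_le hk
  refine (hexp n).trans (mul_le_mul_of_nonneg_left (Real.exp_le_exp.2 ?_) (ha k₀))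
  exact hshift.sum_le_tsum _ fun i _ => hu _

-- The decay is geometric at first, hence summable, so the factors `1 + E * h k` have a convergent
-- product.
lemma exists_le_geometric_of_almost_halving {h : ℕ → ℝ} {η E : ℝ} (hη : 0 < η) (hE : 0 ≤ E)
    (hnonneg : ∀ k, 0 ≤ h k) (hlim : Tendsto h atTop (𝓝 0))
    (hstep : ∀ k, h k ≤ η → h (k + 1) ≤ h k / 2 * (1 + E * h k)) :
    ∃ C, 0 ≤ C ∧ ∀ k, h k ≤ C * (1 / 2) ^ k := by
  have hhalving : ∀ᶠ k in atTop, h (k + 1) ≤ h k / 2 * (1 + E * h k) :=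
    (hlim.eventually_le_const hη).mono hstep
  have hsummable : Summable h := by
    refine summable_of_ratio_norm_eventually_le (r := 3 / 4) (by norm_num) ?_
    filter_upwards [hhalving, (hlim.const_mul E).eventually_le_const (by simp : E * 0 < 1 / 2)]
      with k hk hsmall
    rw [Real.norm_of_nonneg (hnonneg _), Real.norm_of_nonneg (hnonneg _)]
    linarith [mul_le_mul_of_nonneg_left hsmall (hnonneg k)]
  obtain ⟨C, hC⟩ := exists_forall_le_of_le_mul_one_add (a := fun k => h k * 2 ^ k)
    (fun k => mul_nonneg (hnonneg k) (by positivity)) (fun k => mul_nonneg hE (hnonneg k))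
    (hsummable.mul_left E) (hhalving.mono fun k hk => by
      calc h (k + 1) * 2 ^ (k + 1) ≤ h k / 2 * (1 + E * h k) * 2 ^ (k + 1) := by gcongr
        _ = h k * 2 ^ k * (1 + E * h k) := by ring)
  refine ⟨C, by simpa using (hnonneg 0).trans (by simpa using hC 0), fun k => ?_⟩
  calc h k = h k * 2 ^ k * (1 / 2) ^ k := by
        rw [mul_assoc, mul_comm ((2 : ℝ) ^ k), half_pow_mul_two_pow, mul_one]
    _ ≤ C * (1 / 2) ^ k := by gcongr; exact hC k

lemma exists_forall_le_of_periodic {g : ℤ → ℝ} {n : ℕ} (hn : 0 < n) (hg : Function.Periodic g n) :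
    ∃ c, ∀ j, g j ≤ c := by
  obtain ⟨c, hc⟩ := ((Set.finite_Ico (0 : ℤ) n).image g).bddAbove
  refine ⟨c, fun j => ?_⟩
  obtain ⟨i, hi, hij⟩ := hg.exists_mem_Ico₀ (Int.natCast_pos.2 hn) j
  exact hij.trans_le (hc ⟨i, hi, rfl⟩)

lemma exists_forall_le_of_refinement {g : ℕ → ℤ → ℝ} {n : ℕ} {C : ℝ} (hn : 0 < n) (hC : 0 ≤ C)
    (hper : Function.Periodic (g 0) n) (heven : ∀ k j, g (k + 1) (2 * j) = g k j)
    (hodd : ∀ k j, g (k + 1) (2 * j + 1) ≤ g k j + C * (1 / 2) ^ k) : ∃ R, ∀ k j, g k j ≤ R := by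
  obtain ⟨c, hc⟩ := exists_forall_le_of_periodic hn hper
  have hpow (k : ℕ) : 0 ≤ C * (1 / 2 : ℝ) ^ k := by positivity
  have hbound (k : ℕ) (j : ℤ) : g k j ≤ c + 2 * C - 2 * (C * (1 / 2) ^ k) := by
    induction k generalizing j with
    | zero => linarith [hc j]
    | succ k ih =>
      rw [pow_succ]
      rcases Int.even_or_odd' j with ⟨i, rfl | rfl⟩
      · rw [heven]
        linarith [ih i, hpow k]
      · linarith [ih i, hodd k i]
  exact ⟨c + 2 * C, fun k j => by linarith [hbound k j, hpow k]⟩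

end RealSequences

section InsertionAngles

lemma alphaMax_pos : 0 < alphaMax := by
  unfold alphaMax
  linarith [Real.pi_gt_three]

lemma sign_mul_mem_admissibleAngles {s a : ℝ} (hs : s = 1 ∨ s = -1) (ha : a ∈ admissibleAngles) :
    s * a ∈ admissibleAngles := by
  obtain ⟨hlower, hupper⟩ := ha
  rcases hs with rfl | rfl <;> constructor <;> linarith

lemma abs_sin_sign_mul {s : ℝ} (hs : s = 1 ∨ s = -1) (a : ℝ) :
    |Real.sin (s * a)| = |Real.sin a| := by
  rcases hs with rfl | rfl <;> simp

lemma clampAngle_mem (a : ℝ) : clampAngle a ∈ admissibleAngles :=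
  ⟨le_max_left _ _, max_le (by linarith [alphaMax_pos]) (min_le_left _ _)⟩

lemma abs_clampAngle_le (a : ℝ) : |clampAngle a| ≤ |a| := by
  have hpos := alphaMax_pos
  rw [clampAngle, abs_le]
  constructor
  · rcases le_total alphaMax a with h | h
    · rw [min_eq_left h]
      exact le_max_of_le_right (by linarith [abs_nonneg a])
    · rw [min_eq_right h]
      exact le_max_of_le_right (neg_abs_le a)
  · exact max_le (by linarith [abs_nonneg a]) ((min_le_right _ _).trans (le_abs_self a))

end InsertionAngles

section Subdivision

variable {M : Model}

lemma subdivide_even (s : ℝ) (a : ℤ → ℝ) (P : ℤ → M.V) (j : ℤ) :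
    subdivide M s a P (2 * j) = P j := by
  simp [subdivide]

lemma subdivide_odd (s : ℝ) (a : ℤ → ℝ) (P : ℤ → M.V) (j : ℤ) :
    subdivide M s a P (2 * j + 1) = M.insertPt (P j) (P (j + 1)) (s * a j) := by
  have hmod : (2 * j + 1) % 2 = 1 := by omega
  have hdiv : (2 * j + 1) / 2 = j := by omega
  simp only [subdivide, hmod, hdiv, one_ne_zero, if_false]

lemma subdivide_odd_add_one (s : ℝ) (a : ℤ → ℝ) (P : ℤ → M.V) (j : ℤ) :
    subdivide M s a P (2 * j + 1 + 1) = P (j + 1) := by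
  rw [← subdivide_even s a P (j + 1)]
  ring_nf

variable {P : ℤ → M.V} {n : ℕ}

lemma subdivide_periodic {s : ℝ} {a : ℤ → ℝ} (hP : Function.Periodic P n)
    (ha : Function.Periodic a n) : Function.Periodic (subdivide M s a P) (n * 2 : ℕ) := by
  intro j
  have hmod : (j + (n * 2 : ℕ)) % 2 = j % 2 := by push_cast; omega
  have hdiv : (j + (n * 2 : ℕ)) / 2 = j / 2 + n := by push_cast; omega
  simp only [subdivide, hmod, hdiv, hP (j / 2), ha (j / 2), add_right_comm _ (n : ℤ), hP _]

lemma delta_periodic (hP : Function.Periodic P n) : Function.Periodic (delta M P) n := fun j => by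
  simp only [delta, add_sub_right_comm, add_right_comm _ (n : ℤ), hP _]

lemma edge_periodic (hP : Function.Periodic P n) : Function.Periodic (edge M P) n := fun j => by
  simp only [edge, add_right_comm _ (n : ℤ), hP _]

lemma feature_periodic (hP : Function.Periodic P n) (m : ℕ) :
    Function.Periodic (feature M m P) n := fun j => by
  simp only [feature, add_sub_right_comm, add_right_comm _ (n : ℤ), delta_periodic hP _,
    edge_periodic hP _]

lemma classicalAngle_periodic (hP : Function.Periodic P n) (μ : ℝ) :
    Function.Periodic (classicalAngle M μ P) n := fun j => by
  simp only [classicalAngle, add_sub_right_comm, add_right_comm _ (n : ℤ), delta_periodic hP _]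

lemma edge_le_meshWidth (hn : 0 < n) (hP : Function.Periodic P n) (j : ℤ) :
    edge M P j ≤ meshWidth M n P := by
  obtain ⟨i, ⟨hi, hin⟩, hij⟩ := (edge_periodic hP).exists_mem_Ico₀ (Int.natCast_pos.2 hn) j
  lift i to ℕ using hi
  rw [hij]
  exact le_ciSup (f := fun i : Fin n => edge M P (i : ℕ)) (Set.finite_range _).bddAbove
    ⟨i, Int.ofNat_lt.1 hin⟩

lemma meshWidth_le (hn : 0 < n) {b : ℝ} (h : ∀ j, edge M P j ≤ b) : meshWidth M n P ≤ b := by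
  have : Nonempty (Fin n) := ⟨⟨0, hn⟩⟩
  exact ciSup_le fun i => h _

lemma abs_delta_le_of_norm_angleFeature_le {b : ℝ} {j : ℤ} (h : ‖angleFeature M n P j‖ ≤ b) :
    |delta M P j| ≤ Real.pi * b := by
  have hentry : ‖delta M P j / Real.pi‖ ≤ b := (norm_le_pi_norm (angleFeature M n P j) 1).trans h
  rwa [norm_div, Real.norm_eq_abs, Real.norm_of_nonneg Real.pi_pos.le,
    div_le_iff₀' Real.pi_pos] at hentry

lemma abs_classicalAngle_zero_le {b : ℝ} (h : ∀ j, |delta M P j| ≤ b) (j : ℤ) :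
    |classicalAngle M 0 P j| ≤ b := by
  refine (abs_clampAngle_le _).trans ?_
  have hleft := abs_le.1 (h j)
  have hright := abs_le.1 (h (j + 1))
  rw [abs_le]
  constructor <;> linarith [(abs_nonneg _).trans (h j)]

lemma neuralIter_succ (s : ℝ) (f : (Fin 7 → ℝ) → ℝ) (N : ℕ) (P : ℤ → M.V) (k : ℕ) :
    neuralIter M s f N P (k + 1) = subdivide M s
      (fun j => f (feature M (N * 2 ^ k) (neuralIter M s f N P k) j)) (neuralIter M s f N P k) :=
  rfl

lemma neuralIter_periodic {s : ℝ} {f : (Fin 7 → ℝ) → ℝ} {N : ℕ} (hP : Function.Periodic P N)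
    (k : ℕ) : Function.Periodic (neuralIter M s f N P k) (N * 2 ^ k : ℕ) := by
  induction k with
  | zero => simpa [neuralIter] using hP
  | succ k ih =>
    rw [pow_succ, ← mul_assoc, neuralIter_succ]
    exact subdivide_periodic ih ((feature_periodic ih _).comp f)

end Subdivision

/-- The metric estimates on a model that the convergence proof uses, with constant `B` for edges
shorter than `η`: the size of the two new edges, the exterior angle at the inserted point, and the
dependence of that point on the insertion angle. Chords and their turning are compared with edges
and exterior angles only on sub-level sets of a gauge `ρ`, which keeps the polygons away from the
ideal boundary of the hyperbolic disk; on the other two models `ρ = 0` works. -/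
structure HasLocalEstimates (M : Model) (ρ : M.V → ℝ) (B η : ℝ) : Prop where
  nonneg : 0 ≤ B
  pos : 0 < η
  gdist_self {p : M.V} : p ∈ M.carrier → M.gdist p p = 0
  gdist_pos {p q : M.V} : p ∈ M.carrier → q ∈ M.carrier → M.goodEdge p q → 0 < M.gdist p q
  ne_of_goodEdge {p q : M.V} : M.goodEdge p q → p ≠ q
  insertPt_mem {p q : M.V} {α : ℝ} : p ∈ M.carrier → q ∈ M.carrier → M.goodEdge p q →
    α ∈ admissibleAngles → M.insertPt p q α ∈ M.carrier
  gdist_left_le {p q : M.V} {α : ℝ} : p ∈ M.carrier → q ∈ M.carrier → M.goodEdge p q →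
    α ∈ admissibleAngles → M.gdist p q ≤ η →
    M.gdist p (M.insertPt p q α) ≤ M.gdist p q / 2 * (1 + B * (M.gdist p q + |Real.sin α|))
  gdist_right_le {p q : M.V} {α : ℝ} : p ∈ M.carrier → q ∈ M.carrier → M.goodEdge p q →
    α ∈ admissibleAngles → M.gdist p q ≤ η →
    M.gdist (M.insertPt p q α) q ≤ M.gdist p q / 2 * (1 + B * (M.gdist p q + |Real.sin α|))
  abs_sin_le {p q : M.V} {α : ℝ} : p ∈ M.carrier → q ∈ M.carrier → M.goodEdge p q →
    α ∈ admissibleAngles →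
    |Real.sin α| ≤ B * (|M.extAngle p (M.insertPt p q α) q| + M.gdist p q)
  gdist_insertPt_le {p q : M.V} {α β : ℝ} : p ∈ M.carrier → q ∈ M.carrier → M.goodEdge p q →
    α ∈ admissibleAngles → β ∈ admissibleAngles → M.gdist p q ≤ η →
    M.gdist (M.insertPt p q α) (M.insertPt p q β) ≤
      B * M.gdist p q * (M.gdist p q + |Real.sin α| + |Real.sin β|)
  gauge_le {p q : M.V} : p ∈ M.carrier → q ∈ M.carrier → ρ q ≤ ρ p + M.gdist p q
  isClosed_gauge_le (R : ℝ) : IsClosed {p ∈ M.carrier | ρ p ≤ R}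
  exists_chord_le (R : ℝ) : ∃ A, 0 ≤ A ∧ ∀ a p b, a ∈ M.carrier → p ∈ M.carrier → b ∈ M.carrier →
    ρ a ≤ R → ρ p ≤ R → ρ b ≤ R → M.goodEdge a p → M.goodEdge p b →
      ‖b - p‖ ≤ A * M.gdist p b ∧
      ‖chordDir p b - chordDir a p‖ ≤ |M.extAngle a p b| + A * (M.gdist a p + M.gdist p b)

lemma HasLocalEstimates.gdist_subdivide_le {M : Model} {ρ : M.V → ℝ} {B η s h σ τ : ℝ}
    (hM : HasLocalEstimates M ρ B η) {P : ℤ → M.V} {a b : ℤ → ℝ}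
    (hmem : ∀ j, P j ∈ M.carrier) (hgood : ∀ j, M.goodEdge (P j) (P (j + 1)))
    (hedge : ∀ j, edge M P j ≤ h) (hh : h ≤ η)
    (ha : ∀ j, s * a j ∈ admissibleAngles) (hb : ∀ j, s * b j ∈ admissibleAngles)
    (hσ : ∀ j, |Real.sin (s * a j)| ≤ σ) (hτ : ∀ j, |Real.sin (s * b j)| ≤ τ) (j : ℤ) :
    M.gdist (subdivide M s a P j) (subdivide M s b P j) ≤ B * h * (h + σ + τ) := by
  have hB := hM.nonneg
  have hpos (i : ℤ) : 0 < edge M P i := hM.gdist_pos (hmem i) (hmem _) (hgood i)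
  have hh0 : 0 ≤ h := (hpos 0).le.trans (hedge 0)
  have hσ0 : 0 ≤ σ := (abs_nonneg _).trans (hσ 0)
  have hτ0 : 0 ≤ τ := (abs_nonneg _).trans (hτ 0)
  rcases Int.even_or_odd' j with ⟨i, rfl | rfl⟩
  · rw [subdivide_even, subdivide_even, hM.gdist_self (hmem i)]
    positivity
  · rw [subdivide_odd, subdivide_odd]
    refine (hM.gdist_insertPt_le (hmem i) (hmem _) (hgood i) (ha i) (hb i)
      ((hedge i).trans hh)).trans ?_
    have hedge_i := hedge i
    have hpos_i := hpos i
    rw [edge] at hedge_i hpos_i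
    gcongr
    exacts [hσ i, hτ i]

section InsertionSequences

/-- A sequence of closed polygons in which `P (k + 1)` arises from `P k` by inserting a vertex with
the angle `a k j` on every edge `j`, with mesh widths tending to zero and decaying angles. -/
structure IsInsertionSequence (M : Model) (s : ℝ) (N : ℕ) (a : ℕ → ℤ → ℝ) (P : ℕ → ℤ → M.V)
    (K : ℝ) : Prop where
  sign : s = 1 ∨ s = -1
  pos : 0 < N
  mem_zero : ∀ j, P 0 j ∈ M.carrier
  periodic : ∀ k, Function.Periodic (P k) (N * 2 ^ k : ℕ)
  succ : ∀ k, P (k + 1) = subdivide M s (a k) (P k)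
  angle_mem : ∀ k j, a k j ∈ admissibleAngles
  angle_periodic : ∀ k, Function.Periodic (a k) (N * 2 ^ k : ℕ)
  goodEdge : ∀ k j, M.goodEdge (P k j) (P k (j + 1))
  decay : AngleDecay M K N P

/-- The mesh width of the `k`-th polygon, which has `N * 2 ^ k` vertices. -/
abbrev levelWidth (M : Model) (N : ℕ) (P : ℕ → ℤ → M.V) (k : ℕ) : ℝ :=
  meshWidth M (N * 2 ^ k) (P k)

/-- The constant `σ` in the bound `|sin α| ≤ σ * h` for the insertion angles `α` on polygons of mesh
width `h ≤ η`, when the exterior angles of the refined polygon are at most `π * K` times its own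
mesh width `h' ≤ (1 + B * (η + 1)) * h`. -/
def angleRate (B η K : ℝ) : ℝ := B * (Real.pi * K * (1 + B * (η + 1)) + 1)

lemma angleRate_nonneg {B η K : ℝ} (hB : 0 ≤ B) (hη : 0 ≤ η) (hK : 0 ≤ K) :
    0 ≤ angleRate B η K := by
  unfold angleRate
  positivity

namespace IsInsertionSequence

variable {M : Model} {ρ : M.V → ℝ} {B η s : ℝ} {N : ℕ} {a : ℕ → ℤ → ℝ} {P : ℕ → ℤ → M.V} {K : ℝ}

lemma even (H : IsInsertionSequence M s N a P K) (k : ℕ) (j : ℤ) : P (k + 1) (2 * j) = P k j := by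
  rw [H.succ, subdivide_even]

lemma odd (H : IsInsertionSequence M s N a P K) (k : ℕ) (j : ℤ) :
    P (k + 1) (2 * j + 1) = M.insertPt (P k j) (P k (j + 1)) (s * a k j) := by
  rw [H.succ, subdivide_odd]

lemma odd_add_one (H : IsInsertionSequence M s N a P K) (k : ℕ) (j : ℤ) :
    P (k + 1) (2 * j + 1 + 1) = P k (j + 1) := by
  rw [H.succ, subdivide_odd_add_one]

lemma card_pos (H : IsInsertionSequence M s N a P K) (k : ℕ) : 0 < N * 2 ^ k :=
  Nat.mul_pos H.pos (by positivity)

lemma edge_le (H : IsInsertionSequence M s N a P K) (k : ℕ) (j : ℤ) :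
    edge M (P k) j ≤ levelWidth M N P k :=
  edge_le_meshWidth (H.card_pos k) (H.periodic k) j

lemma sign_mul_angle_mem (H : IsInsertionSequence M s N a P K) (k : ℕ) (j : ℤ) :
    s * a k j ∈ admissibleAngles :=
  sign_mul_mem_admissibleAngles H.sign (H.angle_mem k j)

lemma abs_delta_le (H : IsInsertionSequence M s N a P K) (k : ℕ) (j : ℤ) :
    |delta M (P k) j| ≤ Real.pi * (K * levelWidth M N P k) :=
  abs_delta_le_of_norm_angleFeature_le (H.decay.2 k j)

lemma abs_sin_classicalAngle_le (H : IsInsertionSequence M s N a P K) (k : ℕ) (j : ℤ) :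
    |Real.sin (s * classicalAngle M 0 (P k) j)| ≤ Real.pi * K * levelWidth M N P k := by
  rw [abs_sin_sign_mul H.sign, mul_assoc]
  exact Real.abs_sin_le_abs.trans (abs_classicalAngle_zero_le (H.abs_delta_le k) j)

lemma mem_carrier (H : IsInsertionSequence M s N a P K) (hM : HasLocalEstimates M ρ B η) (k : ℕ)
    (j : ℤ) : P k j ∈ M.carrier := by
  induction k generalizing j with
  | zero => exact H.mem_zero j
  | succ k ih =>
    rcases Int.even_or_odd' j with ⟨i, rfl | rfl⟩
    · rw [H.even]
      exact ih i
    · rw [H.odd]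
      exact hM.insertPt_mem (ih _) (ih _) (H.goodEdge k i) (H.sign_mul_angle_mem k i)

lemma edge_pos (H : IsInsertionSequence M s N a P K) (hM : HasLocalEstimates M ρ B η) (k : ℕ)
    (j : ℤ) : 0 < edge M (P k) j :=
  hM.gdist_pos (H.mem_carrier hM k _) (H.mem_carrier hM k _) (H.goodEdge k j)

lemma levelWidth_pos (H : IsInsertionSequence M s N a P K) (hM : HasLocalEstimates M ρ B η)
    (k : ℕ) : 0 < levelWidth M N P k :=
  (H.edge_pos hM k 0).trans_le (H.edge_le k 0)

lemma decay_const_nonneg (H : IsInsertionSequence M s N a P K)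
    (hM : HasLocalEstimates M ρ B η) : 0 ≤ K :=
  nonneg_of_mul_nonneg_left ((norm_nonneg _).trans (H.decay.2 0 0)) (H.levelWidth_pos hM 0)

lemma levelWidth_succ_le (H : IsInsertionSequence M s N a P K) (hM : HasLocalEstimates M ρ B η)
    {k : ℕ} (hk : levelWidth M N P k ≤ η) {σ : ℝ} (hσ : ∀ j, |Real.sin (s * a k j)| ≤ σ) :
    levelWidth M N P (k + 1) ≤
      levelWidth M N P k / 2 * (1 + B * (levelWidth M N P k + σ)) := by
  have hB := hM.nonneg
  have hwidth := H.levelWidth_pos hM k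
  have hbound (i : ℤ) : edge M (P k) i / 2 *
      (1 + B * (edge M (P k) i + |Real.sin (s * a k i)|)) ≤
        levelWidth M N P k / 2 * (1 + B * (levelWidth M N P k + σ)) := by
    have hle := H.edge_le k i
    have hpos := H.edge_pos hM k i
    have hsin := hσ i
    gcongr
  refine meshWidth_le (H.card_pos (k + 1)) fun j => ?_
  rcases Int.even_or_odd' j with ⟨i, rfl | rfl⟩
  · rw [edge, H.even, H.odd]
    exact (hM.gdist_left_le (H.mem_carrier hM k _) (H.mem_carrier hM k _) (H.goodEdge k i)
      (H.sign_mul_angle_mem k i) ((H.edge_le k i).trans hk)).trans (hbound i)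
  · rw [edge, H.odd, H.odd_add_one]
    exact (hM.gdist_right_le (H.mem_carrier hM k _) (H.mem_carrier hM k _) (H.goodEdge k i)
      (H.sign_mul_angle_mem k i) ((H.edge_le k i).trans hk)).trans (hbound i)

lemma delta_odd (H : IsInsertionSequence M s N a P K) (k : ℕ) (j : ℤ) :
    delta M (P (k + 1)) (2 * j + 1) =
      M.extAngle (P k j) (M.insertPt (P k j) (P k (j + 1)) (s * a k j)) (P k (j + 1)) := by
  rw [delta, add_sub_cancel_right, H.even, H.odd, H.odd_add_one]

-- The insertion angle shows up as the exterior angle at the new vertex of the *next* polygon.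
lemma abs_sin_angle_le (H : IsInsertionSequence M s N a P K) (hM : HasLocalEstimates M ρ B η)
    {k : ℕ} (hk : levelWidth M N P k ≤ η) (j : ℤ) :
    |Real.sin (s * a k j)| ≤ angleRate B η K * levelWidth M N P k := by
  have hB := hM.nonneg
  have hη := hM.pos
  have hK := H.decay_const_nonneg hM
  have hpos := H.levelWidth_pos hM k
  have hedge : M.gdist (P k j) (P k (j + 1)) ≤ levelWidth M N P k := H.edge_le k j
  have hnext : levelWidth M N P (k + 1) ≤ levelWidth M N P k * (1 + B * (η + 1)) := by
    calc levelWidth M N P (k + 1)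
        ≤ levelWidth M N P k / 2 * (1 + B * (levelWidth M N P k + 1)) :=
          H.levelWidth_succ_le hM hk fun _ => Real.abs_sin_le_one _
      _ ≤ levelWidth M N P k * (1 + B * (η + 1)) := by
          gcongr
          linarith
  calc |Real.sin (s * a k j)|
      ≤ B * (|delta M (P (k + 1)) (2 * j + 1)| + M.gdist (P k j) (P k (j + 1))) := by
        rw [H.delta_odd]
        exact hM.abs_sin_le (H.mem_carrier hM k _) (H.mem_carrier hM k _) (H.goodEdge k j)
          (H.sign_mul_angle_mem k j)
    _ ≤ B * (Real.pi * (K * (levelWidth M N P k * (1 + B * (η + 1)))) + levelWidth M N P k) := by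
        gcongr
        exact (H.abs_delta_le (k + 1) _).trans (by gcongr)
    _ = angleRate B η K * levelWidth M N P k := by
        rw [angleRate]
        ring

lemma gdist_fourPointStep_le (H : IsInsertionSequence M s N a P K)
    (hM : HasLocalEstimates M ρ B η) {k : ℕ} (hk : levelWidth M N P k ≤ η) (j : ℤ) :
    M.gdist (P (k + 1) j) (fourPointStep M s (P k) j) ≤
      B * (1 + angleRate B η K + Real.pi * K) * levelWidth M N P k ^ 2 := by
  rw [H.succ, fourPointStep]
  refine (hM.gdist_subdivide_le (H.mem_carrier hM k) (H.goodEdge k) (H.edge_le k) hk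
    (H.sign_mul_angle_mem k) (fun j => sign_mul_mem_admissibleAngles H.sign (clampAngle_mem _))
    (H.abs_sin_angle_le hM hk) (H.abs_sin_classicalAngle_le k) j).trans_eq ?_
  ring

lemma exists_gdist_fourPointStep_le (H : IsInsertionSequence M s N a P K)
    (hM : HasLocalEstimates M ρ B η) :
    ∃ C, ∀ k j, M.gdist (P (k + 1) j) (fourPointStep M s (P k) j) ≤ C * levelWidth M N P k ^ 2 := by
  refine exists_forall_of_eventually (fun k c c' hc h j => (h j).trans (by gcongr)) (fun k => ?_)
    ⟨_, (H.decay.1.eventually_le_const hM.pos).mono fun k hk => H.gdist_fourPointStep_le hM hk⟩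
  have hpos : 0 < levelWidth M N P k ^ 2 := pow_pos (H.levelWidth_pos hM k) 2
  have hper : Function.Periodic (fun j => M.gdist (P (k + 1) j) (fourPointStep M s (P k) j))
      (N * 2 ^ k * 2 : ℕ) := fun j => by
    simp only [H.succ, fourPointStep]
    rw [subdivide_periodic (H.periodic k) (H.angle_periodic k),
      subdivide_periodic (H.periodic k) (classicalAngle_periodic (H.periodic k) 0)]
  obtain ⟨c, hc⟩ := exists_forall_le_of_periodic (Nat.mul_pos (H.card_pos k) two_pos) hper
  exact ⟨c / levelWidth M N P k ^ 2, fun j => (hc j).trans_eq (div_mul_cancel₀ c hpos.ne').symm⟩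

lemma exists_levelWidth_le (H : IsInsertionSequence M s N a P K)
    (hM : HasLocalEstimates M ρ B η) :
    ∃ C, 0 ≤ C ∧ ∀ k, levelWidth M N P k ≤ C * (1 / 2) ^ k := by
  have hrate := angleRate_nonneg hM.nonneg hM.pos.le (H.decay_const_nonneg hM)
  refine exists_le_geometric_of_almost_halving hM.pos (E := B * (1 + angleRate B η K))
    (mul_nonneg hM.nonneg (by linarith)) (fun k => (H.levelWidth_pos hM k).le) H.decay.1
    fun k hk => ?_
  refine (H.levelWidth_succ_le hM hk fun j => H.abs_sin_angle_le hM hk j).trans_eq ?_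
  ring

lemma exists_gauge_le (H : IsInsertionSequence M s N a P K) (hM : HasLocalEstimates M ρ B η)
    {C : ℝ} (hC : 0 ≤ C) (hwidth : ∀ k, levelWidth M N P k ≤ C * (1 / 2) ^ k) :
    ∃ R, ∀ k j, ρ (P k j) ≤ R := by
  refine exists_forall_le_of_refinement (g := fun k j => ρ (P k j)) H.pos hC ?_
    (fun k j => by rw [H.even]) fun k j => ?_
  · simpa using (H.periodic 0).comp ρ
  · have hedge := (H.edge_le (k + 1) (2 * j)).trans (hwidth (k + 1))
    have hgauge := hM.gauge_le (H.mem_carrier hM (k + 1) (2 * j))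
      (H.mem_carrier hM (k + 1) (2 * j + 1))
    have hpow : 0 ≤ C * (1 / 2) ^ k := by positivity
    rw [edge, pow_succ] at hedge
    rw [← H.even k j]
    linarith

lemma exists_isRefining (H : IsInsertionSequence M s N a P K) (hM : HasLocalEstimates M ρ B η)
    {C R : ℝ} (hwidth : ∀ k, levelWidth M N P k ≤ C * (1 / 2) ^ k)
    (hgauge : ∀ k j, ρ (P k j) ≤ R) : ∃ A, IsRefining N P A := by
  obtain ⟨A, hA, hchord⟩ := hM.exists_chord_le R
  have hK := H.decay_const_nonneg hM
  have hedge (k : ℕ) (j : ℤ) : M.gdist (P k j) (P k (j + 1)) ≤ C * (1 / 2) ^ k :=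
    (H.edge_le k j).trans (hwidth k)
  have hpow (k : ℕ) : 0 ≤ C * (1 / 2) ^ k := (H.levelWidth_pos hM k).le.trans (hwidth k)
  have hchord' (k : ℕ) (j : ℤ) := hchord _ _ _ (H.mem_carrier hM k j) (H.mem_carrier hM k (j + 1))
    (H.mem_carrier hM k (j + 1 + 1)) (hgauge k _) (hgauge k _) (hgauge k _) (H.goodEdge k _)
    (H.goodEdge k _)
  refine ⟨Real.pi * K * C + 2 * A * C, H.pos, H.periodic, H.even,
    fun k j => hM.ne_of_goodEdge (H.goodEdge k j), fun k j => ?_, fun k j => ?_⟩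
  · have hlength := (hchord' k (j - 1)).1
    rw [sub_add_cancel] at hlength
    rw [dist_eq_norm']
    linarith [mul_le_mul_of_nonneg_left (hedge k j) hA, mul_nonneg hA (hpow k),
      mul_nonneg (mul_nonneg Real.pi_pos.le hK) (hpow k)]
  · have hturn := (hchord' k j).2
    have hdelta := H.abs_delta_le k (j + 1)
    rw [delta, add_sub_cancel_right] at hdelta
    rw [dist_eq_norm', edgeDir, edgeDir]
    linarith [mul_le_mul_of_nonneg_left (add_le_add (hedge k j) (hedge k (j + 1))) hA,
      mul_le_mul_of_nonneg_left (hwidth k) (mul_nonneg Real.pi_pos.le hK)]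

lemma hasC1LimitCurve [CompleteSpace M.V] (H : IsInsertionSequence M s N a P K)
    (hM : HasLocalEstimates M ρ B η) : HasC1LimitCurve M N P := by
  obtain ⟨C, hC, hwidth⟩ := H.exists_levelWidth_le hM
  obtain ⟨R, hgauge⟩ := H.exists_gauge_le hM hC hwidth
  obtain ⟨A, hrefining⟩ := H.exists_isRefining hM hwidth hgauge
  obtain ⟨γ, φ, hsmooth, hregular, hclosed, hclosure, hcont, hmono, hφ, hvertex⟩ :=
    hrefining.exists_curve
  refine ⟨γ, φ, hsmooth, hregular, hclosed, fun t => ?_, hcont, hmono, hφ,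
    fun ε hε => Eventually.of_forall fun k j => ?_⟩
  · have hsub : {x | ∃ k j, P k j = x} ⊆ {p ∈ M.carrier | ρ p ≤ R} := by
      rintro x ⟨k, j, rfl⟩
      exact ⟨H.mem_carrier hM k j, hgauge k j⟩
    exact (closure_minimal hsub (hM.isClosed_gauge_le R) (hclosure t)).1
  · rwa [hvertex, hM.gdist_self (H.mem_carrier hM k j)]

end IsInsertionSequence

lemma isInsertionSequence_neuralIter {M : Model} {s K : ℝ} {f : (Fin 7 → ℝ) → ℝ} {N : ℕ}
    {P : ℤ → M.V} (hs : s = 1 ∨ s = -1) (hf : ∀ x, f x ∈ admissibleAngles)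
    (hP : IsClosedPolygon M N P)
    (hgood : ∀ k j, M.goodEdge (neuralIter M s f N P k j) (neuralIter M s f N P k (j + 1)))
    (hdecay : AngleDecay M K N (neuralIter M s f N P)) :
    IsInsertionSequence M s N
      (fun k j => f (feature M (N * 2 ^ k) (neuralIter M s f N P k) j))
      (neuralIter M s f N P) K where
  sign := hs
  pos := hP.1
  mem_zero := hP.2.2
  periodic := neuralIter_periodic hP.2.1
  succ := neuralIter_succ s f N P
  angle_mem _ _ := hf _
  angle_periodic k := (feature_periodic (neuralIter_periodic hP.2.1 k) _).comp f
  goodEdge := hgood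
  decay := hdecay

end InsertionSequences

section AngleBounds

variable {α : ℝ}

lemma two_thirds_le_cos (hα : α ∈ admissibleAngles) : 2 / 3 ≤ Real.cos α := by
  have habs : |α| ≤ Real.pi / 4 := (abs_le.2 hα).trans (by unfold alphaMax; linarith)
  have hcos := Real.cos_le_cos_of_nonneg_of_le_pi (abs_nonneg α)
    (by linarith [Real.pi_pos] : Real.pi / 4 ≤ Real.pi) habs
  rw [Real.cos_abs, Real.cos_pi_div_four] at hcos
  linarith [Real.le_sqrt_of_sq_le (by norm_num : (4 / 3 : ℝ) ^ 2 ≤ 2)]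

lemma cos_pos_of_mem_admissibleAngles (hα : α ∈ admissibleAngles) : 0 < Real.cos α :=
  (by norm_num : (0 : ℝ) < 2 / 3).trans_le (two_thirds_le_cos hα)

lemma inv_cos_le (hα : α ∈ admissibleAngles) : (Real.cos α)⁻¹ ≤ 1 + 3 / 2 * |Real.sin α| := by
  have hcos := two_thirds_le_cos hα
  have hpyth := Real.sin_sq_add_cos_sq α
  rw [← sq_abs (Real.sin α)] at hpyth
  rw [inv_le_iff_one_le_mul₀ (by linarith)]
  nlinarith [Real.cos_le_one α, Real.abs_sin_le_one α, abs_nonneg (Real.sin α)]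

lemma inv_cos_le_three_halves (hα : α ∈ admissibleAngles) : (Real.cos α)⁻¹ ≤ 3 / 2 :=
  (inv_anti₀ (by norm_num) (two_thirds_le_cos hα)).trans (by norm_num)

lemma abs_tan_le (hα : α ∈ admissibleAngles) : |Real.tan α| ≤ 3 / 2 * |Real.sin α| := by
  rw [Real.tan_eq_sin_div_cos, div_eq_mul_inv, abs_mul, mul_comm,
    abs_of_pos (inv_pos.2 (cos_pos_of_mem_admissibleAngles hα))]
  gcongr
  exact inv_cos_le_three_halves hα

lemma norm_sub_one_le_abs_arg {z : ℂ} (hz : ‖z‖ = 1) : ‖z - 1‖ ≤ |z.arg| :=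
  (Complex.norm_sub_le_angle hz norm_one).trans_eq
    (Complex.angle_one_right (norm_ne_zero_iff.1 (by rw [hz]; exact one_ne_zero)))

lemma two_sub_two_mul_le_sq_atan2 {x y : ℝ} (h : x ^ 2 + y ^ 2 = 1) :
    2 - 2 * x ≤ atan2 y x ^ 2 := by
  have hnorm : ‖(⟨x, y⟩ : ℂ)‖ = 1 := by
    rw [Complex.norm_eq_sqrt_sq_add_sq, h, Real.sqrt_one]
  calc 2 - 2 * x = ‖(⟨x, y⟩ : ℂ) - 1‖ ^ 2 := by
        simp only [Complex.sq_norm, Complex.normSq_apply, Complex.sub_re, Complex.sub_im,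
          Complex.one_re, Complex.one_im]
        linarith
    _ ≤ |(⟨x, y⟩ : ℂ).arg| ^ 2 := by gcongr; exact norm_sub_one_le_abs_arg hnorm
    _ = atan2 y x ^ 2 := sq_abs _

lemma planeAngle_eq_arg (v w : ℂ) : planeAngle v w = (w * conj v).arg := by
  rw [planeAngle, atan2]
  congr 1
  apply Complex.ext <;> simp <;> ring

lemma norm_sub_le_abs_planeAngle {v w : ℂ} (hv : ‖v‖ = 1) (hw : ‖w‖ = 1) :
    ‖w - v‖ ≤ |planeAngle v w| := by
  have hunit : ‖w * conj v‖ = 1 := by rw [norm_mul, RCLike.norm_conj, hv, hw, one_mul]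
  have hconj : v * conj v = 1 := by rw [Complex.mul_conj', hv]; norm_num
  calc ‖w - v‖ = ‖(w - v) * conj v‖ := by rw [norm_mul, RCLike.norm_conj, hv, mul_one]
    _ = ‖w * conj v - 1‖ := by rw [sub_mul, hconj]
    _ ≤ |planeAngle v w| := by
      rw [planeAngle_eq_arg]
      exact norm_sub_one_le_abs_arg hunit

lemma norm_rot (α : ℝ) (v : ℂ) : ‖rot α v‖ = ‖v‖ := by
  rw [rot, norm_mul, Complex.norm_exp_ofReal_mul_I, one_mul]

lemma rot_eq (α : ℝ) (v : ℂ) : rot α v = (Real.cos α + Real.sin α * Complex.I) * v := by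
  rw [rot, Complex.exp_mul_I, Complex.ofReal_cos, Complex.ofReal_sin]

lemma norm_rot_neg_sub_rot (α : ℝ) (v : ℂ) :
    ‖rot (-α) v - rot α v‖ = 2 * |Real.sin α| * ‖v‖ := by
  have hdiff : rot (-α) v - rot α v = ((-2 * Real.sin α : ℝ) : ℂ) * Complex.I * v := by
    rw [rot_eq, rot_eq, Real.cos_neg, Real.sin_neg]
    push_cast
    ring
  rw [hdiff, norm_mul, norm_mul, Complex.norm_I, mul_one, Complex.norm_real, Real.norm_eq_abs,
    abs_mul, abs_neg, abs_two]

end AngleBounds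

section EuclideanPlane

variable {p q : ℂ} {α β : ℝ}

lemma eDir_eq_chordDir (p q : ℂ) : eDir p q = chordDir p q := by
  rw [eDir, chordDir, NormedSpace.normalize, Complex.real_smul, Complex.ofReal_inv, div_eq_inv_mul]

lemma norm_eDir (hpq : p ≠ q) : ‖eDir p q‖ = 1 := by
  rw [eDir_eq_chordDir, norm_chordDir hpq]

lemma norm_mul_eDir (p q : ℂ) : (‖q - p‖ : ℂ) * eDir p q = q - p := by
  rw [eDir_eq_chordDir, ← Complex.real_smul, norm_smul_chordDir]

lemma eDir_add_mul {u : ℂ} {r : ℝ} (hr : 0 < r) (hu : ‖u‖ = 1) : eDir p (p + r * u) = u := by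
  have hr' : (r : ℂ) ≠ 0 := by exact_mod_cast hr.ne'
  rw [eDir, add_sub_cancel_left, norm_mul, hu, Complex.norm_real, Real.norm_of_nonneg hr.le,
    mul_one, mul_div_cancel_left₀ _ hr']

/-- The length `d(p, q_j(α))` of the two sides of the isosceles triangle over the edge `p q` in the
Euclidean plane. -/
def eNew (p q : ℂ) (α : ℝ) : ℝ := ‖q - p‖ / (2 * Real.cos α)

/-- The vertex insertion `euclideanPlane.insertPt`, typed on `ℂ` instead of `euclideanPlane.V` so
that complex arithmetic applies to it. -/
def eInsert (p q : ℂ) (α : ℝ) : ℂ := p + (eNew p q α : ℂ) * rot α (eDir p q)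

lemma eNew_pos (hpq : p ≠ q) (hα : α ∈ admissibleAngles) : 0 < eNew p q α :=
  div_pos (norm_sub_pos_iff.2 hpq.symm) (mul_pos two_pos (cos_pos_of_mem_admissibleAngles hα))

lemma eNew_le (p q : ℂ) (hα : α ∈ admissibleAngles) :
    eNew p q α ≤ ‖q - p‖ / 2 * (1 + 2 * (‖q - p‖ + |Real.sin α|)) := by
  rw [eNew, div_mul_eq_div_div, div_eq_mul_inv (‖q - p‖ / 2)]
  gcongr
  linarith [inv_cos_le hα, abs_nonneg (Real.sin α), norm_nonneg (q - p)]

lemma eInsert_eq (p q : ℂ) (hα : Real.cos α ≠ 0) :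
    eInsert p q α = p + (‖q - p‖ / 2 : ℝ) * (1 + Real.tan α * Complex.I) * eDir p q := by
  have hα' : (Real.cos α : ℂ) ≠ 0 := by exact_mod_cast hα
  rw [eInsert, eNew, rot_eq, Real.tan_eq_sin_div_cos]
  push_cast at hα' ⊢
  field_simp

lemma eInsert_add (p q : ℂ) (hα : Real.cos α ≠ 0) :
    eInsert p q α + (eNew p q α : ℂ) * rot (-α) (eDir p q) = q := by
  have hlength : (eNew p q α : ℂ) * (2 * Real.cos α) = ‖q - p‖ := by
    rw [← Complex.ofReal_ofNat, ← Complex.ofReal_mul, ← Complex.ofReal_mul, eNew,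
      div_mul_cancel₀ _ (mul_ne_zero two_ne_zero hα)]
  rw [eInsert, rot_eq, rot_eq, Real.cos_neg, Real.sin_neg, Complex.ofReal_neg]
  linear_combination norm_mul_eDir p q + eDir p q * hlength

lemma norm_eNew_mul_rot (hpq : p ≠ q) (hα : α ∈ admissibleAngles) (β : ℝ) :
    ‖(eNew p q α : ℂ) * rot β (eDir p q)‖ = eNew p q α := by
  rw [norm_mul, norm_rot, norm_eDir hpq, mul_one, Complex.norm_real,
    Real.norm_of_nonneg (eNew_pos hpq hα).le]

lemma norm_eInsert_sub (hpq : p ≠ q) (hα : α ∈ admissibleAngles) :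
    ‖eInsert p q α - p‖ = eNew p q α := by
  rw [eInsert, add_sub_cancel_left, norm_eNew_mul_rot hpq hα]

lemma norm_sub_eInsert (hpq : p ≠ q) (hα : α ∈ admissibleAngles) :
    ‖q - eInsert p q α‖ = eNew p q α := by
  rw [sub_eq_iff_eq_add'.2 (eInsert_add p q (cos_pos_of_mem_admissibleAngles hα).ne').symm,
    norm_eNew_mul_rot hpq hα]

lemma two_mul_abs_sin_le_planeAngle_eInsert (hpq : p ≠ q) (hα : α ∈ admissibleAngles) :
    2 * |Real.sin α| ≤ |planeAngle (eDir p (eInsert p q α)) (eDir (eInsert p q α) q)| := by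
  have hunit (β : ℝ) : ‖rot β (eDir p q)‖ = 1 := by rw [norm_rot, norm_eDir hpq]
  have hfirst : eDir p (eInsert p q α) = rot α (eDir p q) :=
    eDir_add_mul (eNew_pos hpq hα) (hunit α)
  have hsecond : eDir (eInsert p q α) q = rot (-α) (eDir p q) := by
    simpa only [eInsert_add p q (cos_pos_of_mem_admissibleAngles hα).ne'] using
      eDir_add_mul (p := eInsert p q α) (eNew_pos hpq hα) (hunit (-α))
  rw [hfirst, hsecond]
  simpa only [norm_rot_neg_sub_rot, norm_eDir hpq, mul_one] using
    norm_sub_le_abs_planeAngle (hunit α) (hunit (-α))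

lemma norm_eInsert_sub_eInsert_le (hpq : p ≠ q) (hα : α ∈ admissibleAngles)
    (hβ : β ∈ admissibleAngles) :
    ‖eInsert p q β - eInsert p q α‖ ≤
      2 * ‖q - p‖ * (‖q - p‖ + |Real.sin α| + |Real.sin β|) := by
  have hdiff : eInsert p q β - eInsert p q α =
      ((‖q - p‖ / 2 * (Real.tan β - Real.tan α) : ℝ) : ℂ) * Complex.I * eDir p q := by
    rw [eInsert_eq p q (cos_pos_of_mem_admissibleAngles hα).ne',
      eInsert_eq p q (cos_pos_of_mem_admissibleAngles hβ).ne']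
    push_cast
    ring
  have htan : |Real.tan β - Real.tan α| ≤ 4 * (‖q - p‖ + |Real.sin α| + |Real.sin β|) := by
    linarith [abs_sub (Real.tan β) (Real.tan α), abs_tan_le hα, abs_tan_le hβ,
      norm_nonneg (q - p), abs_nonneg (Real.sin α), abs_nonneg (Real.sin β)]
  calc ‖eInsert p q β - eInsert p q α‖ = ‖q - p‖ / 2 * |Real.tan β - Real.tan α| := by
        rw [hdiff, norm_mul, norm_mul, norm_eDir hpq, Complex.norm_I, Complex.norm_real,
          Real.norm_eq_abs, abs_mul, abs_of_nonneg (by positivity), mul_one, mul_one]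
    _ ≤ ‖q - p‖ / 2 * (4 * (‖q - p‖ + |Real.sin α| + |Real.sin β|)) := by gcongr
    _ = 2 * ‖q - p‖ * (‖q - p‖ + |Real.sin α| + |Real.sin β|) := by ring

lemma norm_chordDir_sub_chordDir_le_planeAngle {a b : ℂ} (hap : a ≠ p) (hpb : p ≠ b) :
    ‖chordDir p b - chordDir a p‖ ≤ |planeAngle (eDir a p) (eDir p b)| := by
  rw [← eDir_eq_chordDir, ← eDir_eq_chordDir]
  exact norm_sub_le_abs_planeAngle (norm_eDir hap) (norm_eDir hpb)

lemma hasLocalEstimates_euclideanPlane : HasLocalEstimates euclideanPlane 0 2 1 where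
  nonneg := zero_le_two
  pos := one_pos
  gdist_self {p : ℂ} _ := show ‖p - p‖ = 0 by simp
  gdist_pos _ _ h := norm_sub_pos_iff.2 (Ne.symm h)
  ne_of_goodEdge h := h
  insertPt_mem _ _ _ _ := Set.mem_univ _
  gdist_left_le _ _ h hα _ := (norm_eInsert_sub h hα).trans_le (eNew_le _ _ hα)
  gdist_right_le _ _ h hα _ := (norm_sub_eInsert h hα).trans_le (eNew_le _ _ hα)
  abs_sin_le {p q : ℂ} {α} _ _ h hα := by
    have hangle := two_mul_abs_sin_le_planeAngle_eInsert h hα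
    change |Real.sin α| ≤ 2 *
      (|planeAngle (eDir p (eInsert p q α)) (eDir (eInsert p q α) q)| + ‖q - p‖)
    linarith [abs_nonneg (Real.sin α), norm_nonneg (q - p)]
  gdist_insertPt_le _ _ h hα hβ _ := norm_eInsert_sub_eInsert_le h hα hβ
  gauge_le {p q : ℂ} _ _ := show (0 : ℝ) ≤ 0 + ‖q - p‖ by positivity
  isClosed_gauge_le R := isClosed_univ.inter (isClosed_const : IsClosed {_p : ℂ | (0 : ℝ) ≤ R})
  exists_chord_le R := ⟨1, zero_le_one, fun (a p b : ℂ) _ _ _ _ _ _ hap hpb =>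
    ⟨(one_mul ‖b - p‖).ge, le_add_of_le_of_nonneg (norm_chordDir_sub_chordDir_le_planeAngle hap hpb)
      (show 0 ≤ 1 * (‖p - a‖ + ‖b - p‖) by positivity)⟩⟩

end EuclideanPlane

section UnitVectors

variable {V : Type*} [NormedAddCommGroup V] [InnerProductSpace ℝ V] {v w : V}

lemma norm_cos_smul_add_sin_smul (hv : ‖v‖ = 1) (hw : ‖w‖ = 1)
    (hvw : inner ℝ v w = 0) (t : ℝ) : ‖Real.cos t • v + Real.sin t • w‖ = 1 := by
  refine (pow_eq_one_iff_of_nonneg (norm_nonneg _) two_ne_zero).1 ?_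
  rw [norm_add_sq_real, norm_smul, norm_smul, hv, hw, real_inner_smul_left, real_inner_smul_right,
    hvw, Real.norm_eq_abs, Real.norm_eq_abs, mul_one, mul_one, sq_abs, sq_abs]
  linarith [Real.sin_sq_add_cos_sq t]

lemma norm_sub_sq_of_norm_eq_one (hv : ‖v‖ = 1) (hw : ‖w‖ = 1) :
    ‖w - v‖ ^ 2 = 2 - 2 * inner ℝ v w := by
  rw [norm_sub_sq_real, hv, hw, real_inner_comm]
  ring

end UnitVectors

section CrossProduct

lemma inner_eq_coords (v w : R3) : inner ℝ v w = v 0 * w 0 + v 1 * w 1 + v 2 * w 2 := by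
  rw [PiLp.inner_apply, Fin.sum_univ_three]
  simp only [RCLike.inner_apply, conj_trivial]
  ring

lemma cross_coords (v w : R3) : cross v w 0 = v 1 * w 2 - v 2 * w 1 ∧
    cross v w 1 = v 2 * w 0 - v 0 * w 2 ∧ cross v w 2 = v 0 * w 1 - v 1 * w 0 := by
  simp [cross, crossProduct]

lemma inner_left_cross (v w : R3) : inner ℝ v (cross v w) = 0 := by
  obtain ⟨hx, hy, hz⟩ := cross_coords v w
  rw [inner_eq_coords, hx, hy, hz]
  ring

lemma inner_right_cross (v w : R3) : inner ℝ w (cross v w) = 0 := by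
  obtain ⟨hx, hy, hz⟩ := cross_coords v w
  rw [inner_eq_coords, hx, hy, hz]
  ring

lemma inner_cross_self (v w : R3) : inner ℝ (cross v w) (cross v w) =
    inner ℝ v v * inner ℝ w w - inner ℝ v w ^ 2 := by
  obtain ⟨hx, hy, hz⟩ := cross_coords v w
  simp only [inner_eq_coords, hx, hy, hz]
  ring

-- The square of a determinant is the Gram determinant of its columns.
lemma sq_inner_cross (u v w : R3) : inner ℝ (cross u v) w ^ 2 =
    inner ℝ u u * inner ℝ v v * inner ℝ w w + 2 * inner ℝ u v * inner ℝ v w * inner ℝ u w -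
      inner ℝ u u * inner ℝ v w ^ 2 - inner ℝ v v * inner ℝ u w ^ 2 -
      inner ℝ w w * inner ℝ u v ^ 2 := by
  obtain ⟨hx, hy, hz⟩ := cross_coords u v
  simp only [inner_eq_coords, hx, hy, hz]
  ring

lemma norm_cross {v w : R3} (hv : ‖v‖ = 1) (hw : ‖w‖ = 1) (hvw : inner ℝ v w = 0) :
    ‖cross v w‖ = 1 := by
  have hsq := inner_cross_self v w
  simp only [real_inner_self_eq_norm_sq, hv, hw, hvw] at hsq
  exact (pow_eq_one_iff_of_nonneg (norm_nonneg _) two_ne_zero).1 (hsq.trans (by norm_num))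

lemma norm_sub_le_abs_atan2 {u w p : R3} (hu : ‖u‖ = 1) (hw : ‖w‖ = 1) (hp : ‖p‖ = 1)
    (hup : inner ℝ u p = 0) (hwp : inner ℝ w p = 0) :
    ‖w - u‖ ≤ |atan2 (inner ℝ (cross u w) p) (inner ℝ u w)| := by
  have hunit : inner ℝ u w ^ 2 + inner ℝ (cross u w) p ^ 2 = (1 : ℝ) := by
    simp only [sq_inner_cross, real_inner_self_eq_norm_sq, hu, hw, hp, hup, hwp]
    ring
  refine (sq_le_sq₀ (norm_nonneg _) (abs_nonneg _)).1 ?_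
  rw [norm_sub_sq_of_norm_eq_one hu hw, sq_abs]
  exact two_sub_two_mul_le_sq_atan2 hunit

end CrossProduct

section SphericalDistance

variable {p q : R3}

lemma sDist_comm (p q : R3) : sDist p q = sDist q p := by rw [sDist, sDist, real_inner_comm]

lemma sDist_nonneg (p q : R3) : 0 ≤ sDist p q := Real.arccos_nonneg _

lemma inner_sDir (hp : ‖p‖ = 1) (q : R3) : inner ℝ p (sDir p q) = 0 := by
  rw [sDir, real_inner_smul_right, inner_sub_right, real_inner_smul_right,
    real_inner_self_eq_norm_sq, hp]
  ring

lemma inner_mem_Icc (hp : ‖p‖ = 1) (hq : ‖q‖ = 1) : inner ℝ p q ∈ Set.Icc (-1 : ℝ) 1 :=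
  abs_le.1 ((abs_real_inner_le_norm p q).trans_eq (by rw [hp, hq, one_mul]))

lemma cos_sDist (hp : ‖p‖ = 1) (hq : ‖q‖ = 1) : Real.cos (sDist p q) = inner ℝ p q :=
  Real.cos_arccos (inner_mem_Icc hp hq).1 (inner_mem_Icc hp hq).2

lemma norm_sub_eq_two_mul_sin (hp : ‖p‖ = 1) (hq : ‖q‖ = 1) :
    ‖q - p‖ = 2 * Real.sin (sDist p q / 2) := by
  have hupper : sDist p q ≤ 2 * Real.pi := (Real.arccos_le_pi _).trans (by linarith [Real.pi_pos])
  rw [Real.sin_half_eq_sqrt (sDist_nonneg p q) hupper, cos_sDist hp hq,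
    ← Real.sqrt_sq (norm_nonneg (q - p)), norm_sub_sq_of_norm_eq_one hp hq,
    show (2 : ℝ) - 2 * inner ℝ p q = 2 ^ 2 * ((1 - inner ℝ p q) / 2) by ring,
    Real.sqrt_mul (sq_nonneg 2), Real.sqrt_sq two_pos.le]

lemma norm_sub_le_sDist (hp : ‖p‖ = 1) (hq : ‖q‖ = 1) : ‖q - p‖ ≤ sDist p q := by
  rw [norm_sub_eq_two_mul_sin hp hq]
  linarith [Real.sin_le (div_nonneg (sDist_nonneg p q) two_pos.le)]

lemma sDist_le_two_mul_norm_sub (hp : ‖p‖ = 1) (hq : ‖q‖ = 1) : sDist p q ≤ 2 * ‖q - p‖ := by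
  have hhalf : 0 ≤ sDist p q / 2 := div_nonneg (sDist_nonneg p q) two_pos.le
  have hupper : sDist p q ≤ Real.pi := Real.arccos_le_pi _
  have hjordan : 2 / Real.pi * (sDist p q / 2) ≤ Real.sin (sDist p q / 2) :=
    Real.mul_le_sin hhalf (by linarith)
  have hpi : 1 / 2 ≤ 2 / Real.pi := by
    rw [div_le_div_iff₀ two_pos Real.pi_pos]
    linarith [Real.pi_le_four]
  rw [norm_sub_eq_two_mul_sin hp hq]
  linarith [mul_le_mul_of_nonneg_right hpi hhalf]

lemma norm_tangent (hp : ‖p‖ = 1) (hq : ‖q‖ = 1) :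
    ‖q - inner ℝ p q • p‖ = Real.sin (sDist p q) := by
  rw [sDist, Real.sin_arccos, eq_comm, Real.sqrt_eq_iff_eq_sq _ (norm_nonneg _), norm_sub_sq_real,
    norm_smul, real_inner_smul_right, hp, hq, Real.norm_eq_abs, mul_one, sq_abs,
    real_inner_comm p q]
  · ring
  · nlinarith [(inner_mem_Icc hp hq).1, (inner_mem_Icc hp hq).2]

lemma sDist_mem_Ioo (hp : ‖p‖ = 1) (hq : ‖q‖ = 1) (hpq : p ≠ q ∧ p ≠ -q) :
    sDist p q ∈ Set.Ioo 0 Real.pi := by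
  have hupper : inner ℝ p q < (1 : ℝ) := lt_of_le_of_ne (inner_mem_Icc hp hq).2 fun h =>
    hpq.1 ((inner_eq_one_iff_of_norm_eq_one hp hq).1 h)
  refine ⟨Real.arccos_pos.2 hupper, lt_of_le_of_ne (Real.arccos_le_pi _) fun h => hpq.2 ?_⟩
  exact (inner_eq_neg_one_iff_of_norm_eq_one hp hq).1
    (by rw [← cos_sDist hp hq, h, Real.cos_pi])

lemma norm_sDir (hp : ‖p‖ = 1) (hq : ‖q‖ = 1) (he : sDist p q ∈ Set.Ioo 0 Real.pi) :
    ‖sDir p q‖ = 1 := by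
  rw [sDir, norm_smul, norm_inv, norm_norm, norm_tangent hp hq,
    inv_mul_cancel₀ (Real.sin_pos_of_mem_Ioo he).ne']

lemma eq_cos_smul_add_sin_smul (hp : ‖p‖ = 1) (hq : ‖q‖ = 1)
    (he : sDist p q ∈ Set.Ioo 0 Real.pi) :
    q = Real.cos (sDist p q) • p + Real.sin (sDist p q) • sDir p q := by
  rw [sDir, norm_tangent hp hq, smul_inv_smul₀ (Real.sin_pos_of_mem_Ioo he).ne', cos_sDist hp hq]
  abel

lemma sin_mul_inner_sDir {x y n : R3} (hx : ‖x‖ = 1) (hy : ‖y‖ = 1)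
    (hxy : sDist x y ∈ Set.Ioo 0 Real.pi) (hny : inner ℝ n y = 0) :
    Real.sin (sDist x y) * inner ℝ n (sDir x y) = -(Real.cos (sDist x y) * inner ℝ n x) := by
  rw [eq_cos_smul_add_sin_smul hx hy hxy, inner_add_right, real_inner_smul_right,
    real_inner_smul_right] at hny
  linear_combination hny

lemma norm_chordDir_sub_sDir_le (hp : ‖p‖ = 1) (hq : ‖q‖ = 1) (hpq : p ≠ q) :
    ‖chordDir p q - sDir p q‖ ≤ sDist p q := by
  have hpos : 0 < ‖q - p‖ := norm_sub_pos_iff.2 hpq.symm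
  have hdiff : ‖(q - p) - (q - inner ℝ p q • p)‖ = 1 - inner ℝ p q := by
    have hsmul : (q - p) - (q - inner ℝ p q • p) = -((1 - inner ℝ p q : ℝ) • p) := by
      rw [sub_smul, one_smul]
      abel
    rw [hsmul, norm_neg, norm_smul, hp, mul_one,
      Real.norm_of_nonneg (sub_nonneg.2 (inner_mem_Icc hp hq).2)]
  have hmul : ‖q - p‖ * ‖chordDir p q - sDir p q‖ ≤ ‖q - p‖ * ‖q - p‖ :=
    (norm_mul_norm_normalize_sub_le _ _).trans_eq (by
      rw [hdiff, ← sq, norm_sub_sq_of_norm_eq_one hp hq]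
      ring)
  exact (le_of_mul_le_mul_left hmul hpos).trans (norm_sub_le_sDist hp hq)

lemma norm_chordDir_sub_chordDir_le_of_sphere {a p b : R3} (ha : ‖a‖ = 1) (hp : ‖p‖ = 1)
    (hb : ‖b‖ = 1) (hap : a ≠ p ∧ a ≠ -p) (hpb : p ≠ b ∧ p ≠ -b) :
    ‖chordDir p b - chordDir a p‖ ≤
      |atan2 (inner ℝ (cross (-sDir p a) (sDir p b)) p) (inner ℝ (-sDir p a) (sDir p b))| +
        (sDist a p + sDist p b) := by
  have hpa : sDist p a ∈ Set.Ioo 0 Real.pi := by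
    rw [sDist_comm]
    exact sDist_mem_Ioo ha hp hap
  have hturn := norm_sub_le_abs_atan2 (u := -sDir p a) (w := sDir p b)
    (by rw [norm_neg, norm_sDir hp ha hpa]) (norm_sDir hp hb (sDist_mem_Ioo hp hb hpb)) hp
    (by rw [inner_neg_left, real_inner_comm, inner_sDir hp, neg_zero])
    (by rw [real_inner_comm, inner_sDir hp])
  have hsplit : chordDir p b - chordDir a p = (chordDir p b - sDir p b) +
      (chordDir p a - sDir p a) + (sDir p b - -sDir p a) := by
    rw [chordDir_comm p a]
    abel
  rw [hsplit, sDist_comm a p]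
  linarith [norm_add₃_le (a := chordDir p b - sDir p b) (b := chordDir p a - sDir p a)
    (c := sDir p b - -sDir p a), norm_chordDir_sub_sDir_le hp hb hpb.1,
    norm_chordDir_sub_sDir_le hp ha hap.1.symm]

end SphericalDistance

section SphericalInsertion

variable {p q : R3} {α β : ℝ}

/-- The vertex insertion `sphere.insertPt`, typed on `R3` instead of `sphere.V` so that the vector
operations of `R3` apply to it. -/
def sInsert (p q : R3) (α : ℝ) : R3 :=
  Real.cos (sNew p q α) • p +
    Real.sin (sNew p q α) • (Real.cos α • sDir p q + Real.sin α • cross p (sDir p q))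

lemma tan_sNew (p q : R3) (α : ℝ) :
    Real.tan (sNew p q α) = Real.tan (sDist p q / 2) / Real.cos α :=
  Real.tan_arctan _

lemma cos_sNew_pos (p q : R3) (α : ℝ) : 0 < Real.cos (sNew p q α) := Real.cos_arctan_pos _

lemma sin_sNew_mul_cos (p q : R3) (hα : Real.cos α ≠ 0) :
    Real.sin (sNew p q α) * Real.cos α = Real.cos (sNew p q α) * Real.tan (sDist p q / 2) := by
  have htan := tan_sNew p q α
  rw [Real.tan_eq_sin_div_cos, div_eq_div_iff (cos_sNew_pos p q α).ne' hα] at htan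
  linarith

lemma sInsert_eq (p q : R3) (hα : Real.cos α ≠ 0) :
    sInsert p q α = Real.cos (sNew p q α) • (p + Real.tan (sDist p q / 2) • sDir p q) +
      (Real.sin (sNew p q α) * Real.sin α) • cross p (sDir p q) := by
  rw [sInsert, smul_add, smul_smul, smul_smul, sin_sNew_mul_cos p q hα, smul_add, smul_smul,
    add_assoc]

lemma norm_sInsert (hp : ‖p‖ = 1) (hq : ‖q‖ = 1) (he : sDist p q ∈ Set.Ioo 0 Real.pi) (α : ℝ) :
    ‖sInsert p q α‖ = 1 := by
  have hD := norm_sDir hp hq he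
  have hpD := inner_sDir hp q
  refine norm_cos_smul_add_sin_smul hp (norm_cos_smul_add_sin_smul hD (norm_cross hp hD hpD)
    (inner_right_cross p _) α) ?_ _
  rw [inner_add_right, real_inner_smul_right, real_inner_smul_right, hpD, inner_left_cross,
    mul_zero, mul_zero, add_zero]

lemma inner_left_sInsert (hp : ‖p‖ = 1) (q : R3) (α : ℝ) :
    inner ℝ p (sInsert p q α) = Real.cos (sNew p q α) := by
  simp only [sInsert, inner_add_right, real_inner_smul_right, real_inner_self_eq_norm_sq, hp,
    inner_sDir hp, inner_left_cross]
  ring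

lemma inner_cross_sDir_left (p q : R3) : inner ℝ (cross p (sDir p q)) p = 0 := by
  rw [real_inner_comm, inner_left_cross]

lemma inner_cross_sDir_right (hp : ‖p‖ = 1) (hq : ‖q‖ = 1)
    (he : sDist p q ∈ Set.Ioo 0 Real.pi) : inner ℝ (cross p (sDir p q)) q = 0 := by
  nth_rewrite 2 [eq_cos_smul_add_sin_smul hp hq he]
  rw [inner_add_right, real_inner_smul_right, real_inner_smul_right, inner_cross_sDir_left,
    real_inner_comm, inner_right_cross, mul_zero, mul_zero, add_zero]

lemma inner_cross_sDir_sInsert (hp : ‖p‖ = 1) (hq : ‖q‖ = 1)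
    (he : sDist p q ∈ Set.Ioo 0 Real.pi) (α : ℝ) :
    inner ℝ (cross p (sDir p q)) (sInsert p q α) = Real.sin (sNew p q α) * Real.sin α := by
  have hnormal := norm_cross hp (norm_sDir hp hq he) (inner_sDir hp q)
  have hnormal_sDir : inner ℝ (cross p (sDir p q)) (sDir p q) = 0 := by
    rw [real_inner_comm, inner_right_cross]
  simp only [sInsert, inner_add_right, real_inner_smul_right, inner_cross_sDir_left, hnormal_sDir,
    real_inner_self_eq_norm_sq, hnormal]
  ring

lemma cos_add_sin_mul_tan_half {e : ℝ} (he : Real.cos (e / 2) ≠ 0) :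
    Real.cos e + Real.sin e * Real.tan (e / 2) = 1 := by
  obtain ⟨t, rfl⟩ : ∃ t, e = 2 * t := ⟨e / 2, by ring⟩
  rw [mul_div_cancel_left₀ t two_ne_zero] at he ⊢
  rw [Real.cos_two_mul, Real.sin_two_mul]
  linear_combination 2 * Real.sin_sq_add_cos_sq t + 2 * Real.sin t * Real.tan_mul_cos he

lemma inner_right_sInsert (hp : ‖p‖ = 1) (hq : ‖q‖ = 1) (he : sDist p q ∈ Set.Ioo 0 Real.pi)
    (hα : Real.cos α ≠ 0) : inner ℝ q (sInsert p q α) = Real.cos (sNew p q α) := by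
  have hhalf : Real.cos (sDist p q / 2) ≠ 0 :=
    (Real.cos_pos_of_mem_Ioo ⟨by linarith [he.1, Real.pi_pos], by linarith [he.2]⟩).ne'
  have hqp : inner ℝ q p = Real.cos (sDist p q) := by rw [cos_sDist hp hq, real_inner_comm]
  have hqD : inner ℝ q (sDir p q) = Real.sin (sDist p q) := by
    nth_rewrite 1 [eq_cos_smul_add_sin_smul hp hq he]
    rw [inner_add_left, real_inner_smul_left, real_inner_smul_left, inner_sDir hp,
      real_inner_self_eq_norm_sq, norm_sDir hp hq he]
    ring
  rw [sInsert_eq p q hα, inner_add_right, real_inner_smul_right, inner_add_right,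
    real_inner_smul_right, real_inner_smul_right, hqp, hqD, real_inner_comm,
    inner_cross_sDir_right hp hq he]
  linear_combination Real.cos (sNew p q α) * cos_add_sin_mul_tan_half hhalf

lemma tan_half_pos (he : sDist p q ∈ Set.Ioo 0 Real.pi) : 0 < Real.tan (sDist p q / 2) :=
  Real.tan_pos_of_pos_of_lt_pi_div_two (half_pos he.1) (by linarith [he.2])

lemma sNew_mem_Ioo (he : sDist p q ∈ Set.Ioo 0 Real.pi) (hα : α ∈ admissibleAngles) :
    sNew p q α ∈ Set.Ioo 0 (Real.pi / 2) :=
  ⟨Real.arctan_pos.2 (div_pos (tan_half_pos he) (cos_pos_of_mem_admissibleAngles hα)),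
    Real.arctan_lt_pi_div_two _⟩

lemma sDist_left_sInsert (hp : ‖p‖ = 1) (he : sDist p q ∈ Set.Ioo 0 Real.pi)
    (hα : α ∈ admissibleAngles) : sDist p (sInsert p q α) = sNew p q α := by
  obtain ⟨hlower, hupper⟩ := sNew_mem_Ioo he hα
  rw [sDist, inner_left_sInsert hp, Real.arccos_cos hlower.le (by linarith)]

lemma sDist_sInsert_right (hp : ‖p‖ = 1) (hq : ‖q‖ = 1) (he : sDist p q ∈ Set.Ioo 0 Real.pi)
    (hα : α ∈ admissibleAngles) : sDist (sInsert p q α) q = sNew p q α := by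
  obtain ⟨hlower, hupper⟩ := sNew_mem_Ioo he hα
  rw [sDist_comm, sDist, inner_right_sInsert hp hq he (cos_pos_of_mem_admissibleAngles hα).ne',
    Real.arccos_cos hlower.le (by linarith)]

lemma tan_half_le {e : ℝ} (he : 0 ≤ e) (he' : e ≤ 1) : Real.tan (e / 2) ≤ e / 2 * (1 + e) := by
  have hcos : 0 < Real.cos (e / 2) :=
    Real.cos_pos_of_mem_Ioo ⟨by linarith [Real.pi_pos], by linarith [Real.pi_gt_three]⟩
  have hmul : 1 ≤ (1 + e) * Real.cos (e / 2) := by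
    nlinarith [Real.one_sub_sq_div_two_le_cos (x := e / 2)]
  rw [Real.tan_eq_sin_div_cos, div_le_iff₀ hcos, mul_assoc]
  exact (Real.sin_le (by linarith)).trans (le_mul_of_one_le_right (by linarith) hmul)

lemma sNew_le_mul_inv_cos (he : sDist p q ∈ Set.Ioo 0 Real.pi) (he' : sDist p q ≤ 1)
    (hα : α ∈ admissibleAngles) :
    sNew p q α ≤ sDist p q / 2 * (1 + sDist p q) * (Real.cos α)⁻¹ := by
  obtain ⟨hlower, hupper⟩ := sNew_mem_Ioo he hα
  have hcos := cos_pos_of_mem_admissibleAngles hα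
  calc sNew p q α ≤ Real.tan (sNew p q α) := Real.le_tan hlower.le hupper
    _ = Real.tan (sDist p q / 2) * (Real.cos α)⁻¹ := by rw [tan_sNew, div_eq_mul_inv]
    _ ≤ sDist p q / 2 * (1 + sDist p q) * (Real.cos α)⁻¹ := by
      gcongr
      exact tan_half_le he.1.le he'

lemma sNew_le (he : sDist p q ∈ Set.Ioo 0 Real.pi) (he' : sDist p q ≤ 1)
    (hα : α ∈ admissibleAngles) :
    sNew p q α ≤ sDist p q / 2 * (1 + 5 * (sDist p q + |Real.sin α|)) := by
  have hpos := he.1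
  have hprod := mul_le_mul_of_nonneg_right he' (abs_nonneg (Real.sin α))
  calc sNew p q α ≤ sDist p q / 2 * (1 + sDist p q) * (Real.cos α)⁻¹ :=
        sNew_le_mul_inv_cos he he' hα
    _ ≤ sDist p q / 2 * (1 + sDist p q) * (1 + 3 / 2 * |Real.sin α|) := by
      gcongr
      exact inv_cos_le hα
    _ ≤ sDist p q / 2 * (1 + 5 * (sDist p q + |Real.sin α|)) := by
      rw [mul_assoc]
      gcongr
      nlinarith [abs_nonneg (Real.sin α)]

lemma sNew_le_three_halves (he : sDist p q ∈ Set.Ioo 0 Real.pi) (he' : sDist p q ≤ 1)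
    (hα : α ∈ admissibleAngles) : sNew p q α ≤ 3 / 2 * sDist p q := by
  have hpos := he.1
  have hcos := cos_pos_of_mem_admissibleAngles hα
  calc sNew p q α ≤ sDist p q / 2 * (1 + sDist p q) * (Real.cos α)⁻¹ :=
        sNew_le_mul_inv_cos he he' hα
    _ ≤ sDist p q / 2 * (1 + 1) * (3 / 2) := by
      gcongr
      exact inv_cos_le_three_halves hα
    _ = 3 / 2 * sDist p q := by ring

lemma two_mul_cos_mul_abs_sin_le (hp : ‖p‖ = 1) (hq : ‖q‖ = 1)
    (he : sDist p q ∈ Set.Ioo 0 Real.pi) (hα : α ∈ admissibleAngles) :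
    2 * (Real.cos (sNew p q α) * |Real.sin α|) ≤
      ‖sDir (sInsert p q α) q - -sDir (sInsert p q α) p‖ := by
  set x := sInsert p q α
  set n := cross p (sDir p q)
  have hnorm : ‖n‖ = 1 := norm_cross hp (norm_sDir hp hq he) (inner_sDir hp q)
  have hmem : sNew p q α ∈ Set.Ioo 0 Real.pi :=
    ⟨(sNew_mem_Ioo he hα).1, by linarith [(sNew_mem_Ioo he hα).2, Real.pi_pos]⟩
  -- Both `p` and `q` lie in the plane orthogonal to `n`, while `x` does not.
  have hcomponent (y : R3) (hy : ‖y‖ = 1) (hny : inner ℝ n y = 0)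
      (hdist : sDist x y = sNew p q α) :
      inner ℝ n (sDir x y) = -(Real.cos (sNew p q α) * Real.sin α) := by
    have hsin := sin_mul_inner_sDir (norm_sInsert hp hq he α) hy (hdist ▸ hmem) hny
    rw [hdist, inner_cross_sDir_sInsert hp hq he α] at hsin
    exact mul_left_cancel₀ (Real.sin_pos_of_mem_Ioo hmem).ne' (by linear_combination hsin)
  have hinner : inner ℝ n (sDir x q - -sDir x p) = -(2 * (Real.cos (sNew p q α) * Real.sin α)) := by
    rw [inner_sub_right, inner_neg_right,
      hcomponent q hq (inner_cross_sDir_right hp hq he) (sDist_sInsert_right hp hq he hα),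
      hcomponent p hp (inner_cross_sDir_left p q)
        ((sDist_comm x p).trans (sDist_left_sInsert hp he hα))]
    ring
  calc 2 * (Real.cos (sNew p q α) * |Real.sin α|) = |inner ℝ n (sDir x q - -sDir x p)| := by
        rw [hinner, abs_neg, abs_mul, abs_mul, abs_two, abs_of_pos (cos_sNew_pos p q α)]
    _ ≤ ‖n‖ * ‖sDir x q - -sDir x p‖ := abs_real_inner_le_norm _ _
    _ = ‖sDir x q - -sDir x p‖ := by rw [hnorm, one_mul]

lemma abs_sin_le_sphereAngle (hp : ‖p‖ = 1) (hq : ‖q‖ = 1) (he : sDist p q ∈ Set.Ioo 0 Real.pi)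
    (hα : α ∈ admissibleAngles) :
    |Real.sin α| ≤ 5 * (|sphere.extAngle p (sInsert p q α) q| + sDist p q) := by
  set x := sInsert p q α
  have hxnorm : ‖x‖ = 1 := norm_sInsert hp hq he α
  have hmem : sNew p q α ∈ Set.Ioo 0 Real.pi :=
    ⟨(sNew_mem_Ioo he hα).1, by linarith [(sNew_mem_Ioo he hα).2, Real.pi_pos]⟩
  have hxp : sDist x p = sNew p q α := (sDist_comm x p).trans (sDist_left_sInsert hp he hα)
  have hxq : sDist x q = sNew p q α := sDist_sInsert_right hp hq he hα
  have hturn : ‖sDir x q - -sDir x p‖ ≤ |sphere.extAngle p x q| :=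
    norm_sub_le_abs_atan2 (by rw [norm_neg, norm_sDir hxnorm hp (hxp ▸ hmem)])
      (norm_sDir hxnorm hq (hxq ▸ hmem)) hxnorm
      (by rw [inner_neg_left, real_inner_comm, inner_sDir hxnorm, neg_zero])
      (by rw [real_inner_comm, inner_sDir hxnorm])
  have hlower := two_mul_cos_mul_abs_sin_le hp hq he hα
  rcases le_total (sDist p q) (1 / 2) with hshort | hlong
  · have hcos : 1 / 2 ≤ Real.cos (sNew p q α) := by
      nlinarith [Real.one_sub_sq_div_two_le_cos (x := sNew p q α), hmem.1,
        sNew_le_three_halves he (by linarith) hα]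
    nlinarith [abs_nonneg (Real.sin α), he.1, abs_nonneg (sphere.extAngle p x q)]
  · linarith [Real.abs_sin_le_one α, abs_nonneg (sphere.extAngle p x q)]

lemma abs_cos_sNew_sub_cos_sNew_le (he : sDist p q ∈ Set.Ioo 0 Real.pi) (he' : sDist p q ≤ 1)
    (hα : α ∈ admissibleAngles) (hβ : β ∈ admissibleAngles) :
    |Real.cos (sNew p q β) - Real.cos (sNew p q α)| ≤ 9 / 8 * sDist p q ^ 2 := by
  have hlower {γ : ℝ} (hγ : γ ∈ admissibleAngles) :
      1 - 9 / 8 * sDist p q ^ 2 ≤ Real.cos (sNew p q γ) := by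
    have hsq : sNew p q γ ^ 2 ≤ (3 / 2 * sDist p q) ^ 2 :=
      pow_le_pow_left₀ (sNew_mem_Ioo he hγ).1.le (sNew_le_three_halves he he' hγ) 2
    linarith [Real.one_sub_sq_div_two_le_cos (x := sNew p q γ)]
  rw [abs_le]
  constructor <;> linarith [hlower hα, hlower hβ, Real.cos_le_one (sNew p q α),
    Real.cos_le_one (sNew p q β)]

lemma abs_sin_sNew_mul_sin_le (he : sDist p q ∈ Set.Ioo 0 Real.pi) (he' : sDist p q ≤ 1)
    (hα : α ∈ admissibleAngles) :
    |Real.sin (sNew p q α) * Real.sin α| ≤ 3 / 2 * sDist p q * |Real.sin α| := by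
  rw [abs_mul]
  gcongr
  exact (Real.abs_sin_le_abs.trans_eq (abs_of_pos (sNew_mem_Ioo he hα).1)).trans
    (sNew_le_three_halves he he' hα)

lemma sDist_sInsert_sInsert_le (hp : ‖p‖ = 1) (hq : ‖q‖ = 1)
    (he : sDist p q ∈ Set.Ioo 0 Real.pi) (he' : sDist p q ≤ 1) (hα : α ∈ admissibleAngles)
    (hβ : β ∈ admissibleAngles) :
    sDist (sInsert p q α) (sInsert p q β) ≤
      5 * sDist p q * (sDist p q + |Real.sin α| + |Real.sin β|) := by
  set c := Real.cos (sNew p q β) - Real.cos (sNew p q α)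
  set s := Real.sin (sNew p q β) * Real.sin β - Real.sin (sNew p q α) * Real.sin α
  set m := p + Real.tan (sDist p q / 2) • sDir p q
  have hdiff : sInsert p q β - sInsert p q α = c • m + s • cross p (sDir p q) := by
    rw [sInsert_eq p q (cos_pos_of_mem_admissibleAngles hα).ne',
      sInsert_eq p q (cos_pos_of_mem_admissibleAngles hβ).ne', sub_smul, sub_smul]
    abel
  have hm : ‖m‖ ≤ 2 := by
    have htan := tan_half_le he.1.le he'
    refine (norm_add_le _ _).trans ?_
    rw [norm_smul, hp, norm_sDir hp hq he, Real.norm_of_nonneg (tan_half_pos he).le]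
    nlinarith [he.1]
  have hc : |c| ≤ 9 / 8 * sDist p q ^ 2 := abs_cos_sNew_sub_cos_sNew_le he he' hα hβ
  have hs : |s| ≤ 3 / 2 * sDist p q * |Real.sin β| + 3 / 2 * sDist p q * |Real.sin α| :=
    (abs_sub _ _).trans
      (add_le_add (abs_sin_sNew_mul_sin_le he he' hβ) (abs_sin_sNew_mul_sin_le he he' hα))
  have hnorm : ‖sInsert p q β - sInsert p q α‖ ≤ |c| * ‖m‖ + |s| := by
    rw [hdiff]
    refine (norm_add_le _ _).trans_eq ?_
    rw [norm_smul, norm_smul, norm_cross hp (norm_sDir hp hq he) (inner_sDir hp q), mul_one,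
      Real.norm_eq_abs, Real.norm_eq_abs]
  have hcm : |c| * ‖m‖ ≤ 9 / 8 * sDist p q ^ 2 * 2 := by gcongr
  have hmixed : 0 ≤ sDist p q * (sDist p q + |Real.sin α| + |Real.sin β|) :=
    mul_nonneg he.1.le (by linarith [he.1, abs_nonneg (Real.sin α), abs_nonneg (Real.sin β)])
  nlinarith [sDist_le_two_mul_norm_sub (norm_sInsert hp hq he α) (norm_sInsert hp hq he β),
    sq_nonneg (sDist p q), mul_nonneg he.1.le (abs_nonneg (Real.sin α)),
    mul_nonneg he.1.le (abs_nonneg (Real.sin β))]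

lemma norm_of_mem_sphere {p : R3} (hp : p ∈ sphere.carrier) : ‖p‖ = 1 :=
  mem_sphere_zero_iff_norm.1 hp

lemma sDist_mem_Ioo_of_mem_sphere {p q : R3} (hp : p ∈ sphere.carrier) (hq : q ∈ sphere.carrier)
    (h : sphere.goodEdge p q) : sDist p q ∈ Set.Ioo 0 Real.pi :=
  sDist_mem_Ioo (norm_of_mem_sphere hp) (norm_of_mem_sphere hq) h

lemma hasLocalEstimates_sphere : HasLocalEstimates sphere 0 5 1 where
  nonneg := by norm_num
  pos := one_pos
  gdist_self {p : R3} hp := by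
    change Real.arccos (inner ℝ p p) = 0
    rw [real_inner_self_eq_norm_sq, norm_of_mem_sphere hp, one_pow, Real.arccos_one]
  gdist_pos hp hq h := (sDist_mem_Ioo_of_mem_sphere hp hq h).1
  ne_of_goodEdge h := h.1
  insertPt_mem {p q : R3} {α} hp hq h _ := mem_sphere_zero_iff_norm.2
    (norm_sInsert (norm_of_mem_sphere hp) (norm_of_mem_sphere hq)
      (sDist_mem_Ioo_of_mem_sphere hp hq h) α)
  gdist_left_le hp hq h hα he' :=
    have he := sDist_mem_Ioo_of_mem_sphere hp hq h
    (sDist_left_sInsert (norm_of_mem_sphere hp) he hα).trans_le (sNew_le he he' hα)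
  gdist_right_le hp hq h hα he' :=
    have he := sDist_mem_Ioo_of_mem_sphere hp hq h
    (sDist_sInsert_right (norm_of_mem_sphere hp) (norm_of_mem_sphere hq) he hα).trans_le
      (sNew_le he he' hα)
  abs_sin_le hp hq h hα := abs_sin_le_sphereAngle (norm_of_mem_sphere hp)
    (norm_of_mem_sphere hq) (sDist_mem_Ioo_of_mem_sphere hp hq h) hα
  gdist_insertPt_le hp hq h hα hβ he' := sDist_sInsert_sInsert_le (norm_of_mem_sphere hp)
    (norm_of_mem_sphere hq) (sDist_mem_Ioo_of_mem_sphere hp hq h) he' hα hβ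
  gauge_le {p q : R3} _ _ := show (0 : ℝ) ≤ 0 + sDist p q from
    add_nonneg le_rfl (sDist_nonneg p q)
  isClosed_gauge_le R :=
    Metric.isClosed_sphere.inter (isClosed_const : IsClosed {_p : R3 | (0 : ℝ) ≤ R})
  exists_chord_le R := by
    refine ⟨1, zero_le_one, fun (a p b : R3) ha hp hb _ _ _ hap hpb => ?_⟩
    simp only [one_mul]
    exact ⟨norm_sub_le_sDist (norm_of_mem_sphere hp) (norm_of_mem_sphere hb),
      norm_chordDir_sub_chordDir_le_of_sphere (norm_of_mem_sphere ha) (norm_of_mem_sphere hp)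
        (norm_of_mem_sphere hb) hap hpb⟩

end SphericalInsertion

section InverseHyperbolicTangent

variable {y : ℝ}

lemma le_artanh (hy : 0 ≤ y) (hy' : y < 1) : y ≤ Real.artanh y := by
  have hpos : 0 < 1 - y := by linarith
  have hlog := Real.le_log_one_add_of_nonneg (by positivity : 0 ≤ 2 * y / (1 - y))
  have hratio : 1 + 2 * y / (1 - y) = (1 + y) / (1 - y) := by
    field_simp
    ring
  have hlower : 2 * (2 * y / (1 - y)) / (2 * y / (1 - y) + 2) = 2 * y := by
    field_simp
    ring
  rw [hratio, hlower] at hlog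
  rw [Real.artanh_eq_half_log ⟨by linarith, hy'.le⟩]
  linarith

lemma artanh_le_mul_one_add (hy : 0 ≤ y) (hy' : y ≤ 1 / 2) :
    Real.artanh y ≤ y * (1 + 2 * y) := by
  have hpos : 0 < 1 - y := by linarith
  have hlog := Real.log_le_sub_one_of_pos (by positivity : 0 < (1 + y) / (1 - y))
  have hratio : (1 + y) / (1 - y) ≤ 1 + 2 * (y * (1 + 2 * y)) := by
    rw [div_le_iff₀ hpos]
    nlinarith [mul_nonneg hy hy]
  rw [Real.artanh_eq_half_log ⟨by linarith, by linarith⟩]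
  linarith

lemma artanh_le_two_mul (hy : 0 ≤ y) (hy' : y ≤ 1 / 2) : Real.artanh y ≤ 2 * y := by
  nlinarith [artanh_le_mul_one_add hy hy']

lemma tanh_mul_one_add_sq_tanh_half (x : ℝ) :
    Real.tanh x * (1 + Real.tanh (x / 2) ^ 2) = 2 * Real.tanh (x / 2) := by
  obtain ⟨y, rfl⟩ : ∃ y, x = 2 * y := ⟨x / 2, by ring⟩
  have hcosh := Real.cosh_pos y
  have hsum : Real.cosh y ^ 2 + Real.sinh y ^ 2 ≠ 0 := by positivity
  rw [mul_div_cancel_left₀ y two_ne_zero, Real.tanh_eq_sinh_div_cosh, Real.tanh_eq_sinh_div_cosh,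
    Real.sinh_two_mul, Real.cosh_two_mul]
  field_simp

end InverseHyperbolicTangent

section MobiusAddition

variable {z w x : ℂ}

lemma mobiusAdd_neg (z w : ℂ) : mobiusAdd (-z) w = (w - z) / (1 - conj z * w) := by
  rw [mobiusAdd, map_neg, neg_mul, ← sub_eq_add_neg, neg_add_eq_sub]

lemma mobiusAdd_zero (z : ℂ) : mobiusAdd z 0 = z := by simp [mobiusAdd]

lemma norm_conj_mul_lt_one (hz : ‖z‖ < 1) (hw : ‖w‖ < 1) : ‖conj z * w‖ < 1 := by
  rw [norm_mul, RCLike.norm_conj]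
  exact mul_lt_one_of_nonneg_of_lt_one_left (norm_nonneg z) hz hw.le

lemma one_sub_conj_mul_ne_zero (hz : ‖z‖ < 1) (hw : ‖w‖ < 1) : 1 - conj z * w ≠ 0 := fun h => by
  have hnorm := norm_conj_mul_lt_one hz hw
  rw [← sub_eq_zero.1 h, norm_one] at hnorm
  exact hnorm.false

lemma one_add_conj_mul_ne_zero (hz : ‖z‖ < 1) (hw : ‖w‖ < 1) : 1 + conj z * w ≠ 0 := by
  simpa using one_sub_conj_mul_ne_zero (z := -z) (by rwa [norm_neg]) hw

lemma one_sub_norm_mobiusAdd_sq (hz : ‖z‖ < 1) (hw : ‖w‖ < 1) :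
    1 - ‖mobiusAdd z w‖ ^ 2 = (1 - ‖z‖ ^ 2) * (1 - ‖w‖ ^ 2) / ‖1 + conj z * w‖ ^ 2 := by
  have hpos : 0 < ‖1 + conj z * w‖ := norm_pos_iff.2 (one_add_conj_mul_ne_zero hz hw)
  rw [mobiusAdd, norm_div, div_pow, eq_div_iff (by positivity), sub_mul,
    div_mul_cancel₀ _ (by positivity)]
  simp only [Complex.sq_norm, Complex.normSq_apply, Complex.add_re, Complex.add_im, Complex.mul_re,
    Complex.mul_im, Complex.conj_re, Complex.conj_im, Complex.one_re, Complex.one_im]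
  ring

lemma one_sub_sq_norm_pos (hz : ‖z‖ < 1) : 0 < 1 - ‖z‖ ^ 2 :=
  sub_pos.2 (pow_lt_one₀ (norm_nonneg z) hz two_ne_zero)

lemma norm_mobiusAdd_lt_one (hz : ‖z‖ < 1) (hw : ‖w‖ < 1) : ‖mobiusAdd z w‖ < 1 := by
  have hpos : 0 < 1 - ‖mobiusAdd z w‖ ^ 2 := by
    rw [one_sub_norm_mobiusAdd_sq hz hw]
    exact div_pos (mul_pos (one_sub_sq_norm_pos hz) (one_sub_sq_norm_pos hw))
      (pow_pos (norm_pos_iff.2 (one_add_conj_mul_ne_zero hz hw)) 2)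
  exact (pow_lt_one_iff_of_nonneg (norm_nonneg _) two_ne_zero).1 (sub_pos.1 hpos)

/-- The rotation by which Möbius addition fails to be associative, i.e. Ungar's gyration
`gyr[z, w]`, encoded by the complex number of modulus one it multiplies with. -/
def gyration (z w : ℂ) : ℂ := (1 + conj w * z) / (1 + conj z * w)

lemma norm_gyration (hz : ‖z‖ < 1) (hw : ‖w‖ < 1) : ‖gyration z w‖ = 1 := by
  have hconj : 1 + conj w * z = conj (1 + conj z * w) := by
    rw [map_add, map_mul, map_one, Complex.conj_conj, mul_comm]
  rw [gyration, norm_div, hconj, RCLike.norm_conj, div_self]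
  exact norm_ne_zero_iff.2 (one_add_conj_mul_ne_zero hz hw)

lemma mobiusAdd_neg_mobiusAdd (hz : ‖z‖ < 1) (hw : ‖w‖ < 1) (hx : ‖x‖ < 1) :
    mobiusAdd (-mobiusAdd z w) (mobiusAdd z x) = gyration z w * mobiusAdd (-w) x := by
  have hzw := one_add_conj_mul_ne_zero hz hw
  have hzx := one_add_conj_mul_ne_zero hz hx
  have hwx := one_sub_conj_mul_ne_zero hw hx
  have hwz := one_add_conj_mul_ne_zero hw hz
  have hzz := one_sub_conj_mul_ne_zero hz hz
  have hnumerator : mobiusAdd z x - mobiusAdd z w =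
      (x - w) * (1 - conj z * z) / ((1 + conj z * x) * (1 + conj z * w)) := by
    rw [mobiusAdd, mobiusAdd, div_sub_div _ _ hzx hzw]
    congr 1
    ring
  have hconj : conj (mobiusAdd z w) = (conj z + conj w) / (1 + conj w * z) := by
    rw [mobiusAdd, map_div₀, map_add, map_add, map_mul, map_one, Complex.conj_conj, mul_comm z]
  have hdenominator : 1 - conj (mobiusAdd z w) * mobiusAdd z x =
      (1 - conj w * x) * (1 - conj z * z) / ((1 + conj w * z) * (1 + conj z * x)) := by
    rw [hconj, mobiusAdd, div_mul_div_comm, eq_div_iff (mul_ne_zero hwz hzx), sub_mul,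
      div_mul_cancel₀ _ (mul_ne_zero hwz hzx)]
    ring
  rw [mobiusAdd_neg, mobiusAdd_neg, hnumerator, hdenominator, gyration, div_div_div_eq,
    div_mul_div_comm, div_eq_div_iff (mul_ne_zero (mul_ne_zero hzx hzw) (mul_ne_zero hwx hzz))
      (mul_ne_zero hzw hwx)]
  ring

lemma mobiusAdd_neg_cancel (hz : ‖z‖ < 1) (hw : ‖w‖ < 1) :
    mobiusAdd (-z) (mobiusAdd z w) = w := by
  simpa [mobiusAdd, gyration] using mobiusAdd_neg_mobiusAdd hz (w := 0) (by simp) hw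

lemma mobiusAdd_cancel (hz : ‖z‖ < 1) (hw : ‖w‖ < 1) :
    mobiusAdd z (mobiusAdd (-z) w) = w := by
  simpa only [neg_neg] using mobiusAdd_neg_cancel (z := -z) (by rwa [norm_neg]) hw

lemma norm_mobiusAdd_neg_comm (z w : ℂ) : ‖mobiusAdd (-z) w‖ = ‖mobiusAdd (-w) z‖ := by
  have hconj : 1 - conj w * z = conj (1 - conj z * w) := by
    rw [map_sub, map_mul, map_one, Complex.conj_conj, mul_comm]
  rw [mobiusAdd_neg, mobiusAdd_neg, norm_div, norm_div, hconj, RCLike.norm_conj, norm_sub_rev]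

end MobiusAddition

section HyperbolicDistance

variable {p q : ℂ}

lemma hDist_comm (p q : ℂ) : hDist p q = hDist q p := by
  rw [hDist, hDist, norm_mobiusAdd_neg_comm]

lemma norm_mobiusAdd_neg_lt_one (hp : ‖p‖ < 1) (hq : ‖q‖ < 1) : ‖mobiusAdd (-p) q‖ < 1 :=
  norm_mobiusAdd_lt_one (by rwa [norm_neg]) hq

lemma norm_mobiusAdd_neg_pos (hp : ‖p‖ < 1) (hq : ‖q‖ < 1) (hpq : p ≠ q) :
    0 < ‖mobiusAdd (-p) q‖ := by
  rw [mobiusAdd_neg]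
  exact norm_pos_iff.2 (div_ne_zero (sub_ne_zero.2 hpq.symm) (one_sub_conj_mul_ne_zero hp hq))

lemma tanh_half_hDist (hp : ‖p‖ < 1) (hq : ‖q‖ < 1) :
    Real.tanh (hDist p q / 2) = ‖mobiusAdd (-p) q‖ := by
  rw [hDist, mul_div_cancel_left₀ _ two_ne_zero, Real.tanh_artanh]
  exact ⟨by linarith [norm_nonneg (mobiusAdd (-p) q)], norm_mobiusAdd_neg_lt_one hp hq⟩

lemma two_mul_norm_mobiusAdd_neg_le (hp : ‖p‖ < 1) (hq : ‖q‖ < 1) :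
    2 * ‖mobiusAdd (-p) q‖ ≤ hDist p q :=
  mul_le_mul_of_nonneg_left (le_artanh (norm_nonneg _) (norm_mobiusAdd_neg_lt_one hp hq))
    two_pos.le

lemma hDist_pos (hp : ‖p‖ < 1) (hq : ‖q‖ < 1) (hpq : p ≠ q) : 0 < hDist p q :=
  (mul_pos two_pos (norm_mobiusAdd_neg_pos hp hq hpq)).trans_le
    (two_mul_norm_mobiusAdd_neg_le hp hq)

lemma sub_eq_mobiusAdd_neg_mul (hp : ‖p‖ < 1) (hq : ‖q‖ < 1) :
    q - p = mobiusAdd (-p) q * (1 - conj p * q) := by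
  rw [mobiusAdd_neg, div_mul_cancel₀ _ (one_sub_conj_mul_ne_zero hp hq)]

lemma norm_sub_le_hDist (hp : ‖p‖ < 1) (hq : ‖q‖ < 1) : ‖q - p‖ ≤ hDist p q := by
  have hfactor : ‖1 - conj p * q‖ ≤ 2 := by
    linarith [norm_sub_le 1 (conj p * q), norm_conj_mul_lt_one hp hq, norm_one (α := ℂ)]
  rw [sub_eq_mobiusAdd_neg_mul hp hq, norm_mul]
  nlinarith [two_mul_norm_mobiusAdd_neg_le hp hq, norm_nonneg (mobiusAdd (-p) q)]

lemma norm_mul_hDir (hp : ‖p‖ < 1) (hq : ‖q‖ < 1) (hpq : p ≠ q) :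
    (‖mobiusAdd (-p) q‖ : ℂ) * hDir p q = mobiusAdd (-p) q :=
  mul_div_cancel₀ _ (by exact_mod_cast (norm_mobiusAdd_neg_pos hp hq hpq).ne')

lemma norm_hDir (hp : ‖p‖ < 1) (hq : ‖q‖ < 1) (hpq : p ≠ q) : ‖hDir p q‖ = 1 := by
  rw [hDir, norm_div, Complex.norm_real, norm_norm,
    div_self (norm_mobiusAdd_neg_pos hp hq hpq).ne']

lemma hDir_eq_of_mobiusAdd_neg_eq {u : ℂ} {r : ℝ} (hr : 0 < r) (hu : ‖u‖ = 1)
    (h : mobiusAdd (-p) q = r * u) : hDir p q = u := by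
  have hr' : (r : ℂ) ≠ 0 := by exact_mod_cast hr.ne'
  rw [hDir, h, norm_mul, hu, Complex.norm_real, Real.norm_of_nonneg hr.le, mul_one,
    mul_div_cancel_left₀ _ hr']

lemma chordDir_eq_hDir_mul (hp : ‖p‖ < 1) (hq : ‖q‖ < 1) (hpq : p ≠ q) :
    chordDir p q = hDir p q * NormedSpace.normalize (1 - conj p * q) := by
  rw [chordDir, sub_eq_mobiusAdd_neg_mul hp hq, ← norm_mul_hDir hp hq hpq, mul_assoc,
    ← Complex.real_smul, normalize_smul_of_pos (norm_mobiusAdd_neg_pos hp hq hpq),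
    NormedSpace.normalize, NormedSpace.normalize, norm_mul, norm_hDir hp hq hpq, one_mul,
    mul_smul_comm]

lemma norm_chordDir_sub_hDir_le (hp : ‖p‖ < 1) (hq : ‖q‖ < 1) (hpq : p ≠ q) :
    (1 - ‖p‖ ^ 2) * ‖chordDir p q - hDir p q‖ ≤ 2 * hDist p q := by
  have hself : 1 - conj p * p = (1 - ‖p‖ ^ 2 : ℝ) := by
    rw [mul_comm, Complex.mul_conj']
    push_cast
    rfl
  have hnormalize : NormedSpace.normalize (1 - conj p * p) = 1 := by
    rw [hself, ← mul_one ((1 - ‖p‖ ^ 2 : ℝ) : ℂ), ← Complex.real_smul,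
      normalize_smul_of_pos (one_sub_sq_norm_pos hp),
      normalize_eq_self_of_norm_eq_one norm_one]
  calc (1 - ‖p‖ ^ 2) * ‖chordDir p q - hDir p q‖
      = ‖1 - conj p * p‖ * ‖NormedSpace.normalize (1 - conj p * p) -
          NormedSpace.normalize (1 - conj p * q)‖ := by
        rw [chordDir_eq_hDir_mul hp hq hpq, ← mul_sub_one, norm_mul, norm_hDir hp hq hpq, one_mul,
          hnormalize, norm_sub_rev, hself, Complex.norm_real,
          Real.norm_of_nonneg (one_sub_sq_norm_pos hp).le]
    _ ≤ 2 * ‖(1 - conj p * p) - (1 - conj p * q)‖ := norm_mul_norm_normalize_sub_le _ _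
    _ = 2 * (‖p‖ * ‖q - p‖) := by
        rw [sub_sub_sub_cancel_left, ← mul_sub, norm_mul, RCLike.norm_conj]
    _ ≤ 2 * hDist p q := by
        have hle := mul_le_mul hp.le (norm_sub_le_hDist hp hq) (norm_nonneg _) one_pos.le
        linarith

/-- The logarithm of the conformal factor of the Poincaré disk, up to an additive constant. It is
1-Lipschitz for the hyperbolic distance, and Euclidean and hyperbolic quantities are comparable on
its sublevel sets. -/
def conformalGauge (p : ℂ) : ℝ := -Real.log (1 - ‖p‖ ^ 2)

lemma conformalGauge_le_add_hDist (hp : ‖p‖ < 1) (hq : ‖q‖ < 1) :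
    conformalGauge q ≤ conformalGauge p + hDist p q := by
  set b := mobiusAdd (-p) q with hb_def
  have hb : ‖b‖ < 1 := norm_mobiusAdd_neg_lt_one hp hq
  have hb' : 0 < 1 - ‖b‖ := sub_pos.2 hb
  have hp' := one_sub_sq_norm_pos hp
  have hden : 0 < ‖1 + conj p * b‖ := norm_pos_iff.2 (one_add_conj_mul_ne_zero hp hb)
  have hden' : ‖1 + conj p * b‖ ≤ 1 + ‖b‖ := by
    refine (norm_add_le _ _).trans ?_
    rw [norm_one, norm_mul, RCLike.norm_conj]
    nlinarith [norm_nonneg b]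
  have hratio : (1 - ‖p‖ ^ 2) ≤ (1 - ‖q‖ ^ 2) * ((1 + ‖b‖) / (1 - ‖b‖)) := by
    rw [← mobiusAdd_cancel hp hq, ← hb_def, one_sub_norm_mobiusAdd_sq hp hb, div_mul_div_comm,
      le_div_iff₀ (by positivity)]
    have hsq : ‖1 + conj p * b‖ ^ 2 ≤ (1 + ‖b‖) ^ 2 := pow_le_pow_left₀ hden.le hden' 2
    nlinarith [mul_le_mul_of_nonneg_left hsq (mul_pos hp' hb').le]
  have hlog := Real.log_le_log hp' hratio
  rw [Real.log_mul (one_sub_sq_norm_pos hq).ne' (by positivity)] at hlog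
  rw [conformalGauge, conformalGauge, hDist, ← hb_def,
    Real.artanh_eq_half_log ⟨by linarith [norm_nonneg b], hb.le⟩]
  linarith

lemma conformalGauge_le_iff (hp : ‖p‖ < 1) {R : ℝ} :
    conformalGauge p ≤ R ↔ Real.exp (-R) ≤ 1 - ‖p‖ ^ 2 := by
  rw [conformalGauge, neg_le, Real.le_log_iff_exp_le (one_sub_sq_norm_pos hp)]

lemma isClosed_conformalGauge_le (R : ℝ) :
    IsClosed {p : ℂ | p ∈ Metric.ball 0 1 ∧ conformalGauge p ≤ R} := by
  have hset : {p : ℂ | p ∈ Metric.ball 0 1 ∧ conformalGauge p ≤ R} =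
      {p : ℂ | Real.exp (-R) ≤ 1 - ‖p‖ ^ 2} := by
    ext p
    rw [Set.mem_ofPred_eq, Set.mem_ofPred_eq, mem_ball_zero_iff]
    refine ⟨fun h => (conformalGauge_le_iff h.1).1 h.2, fun h => ?_⟩
    have hp : ‖p‖ < 1 := (pow_lt_one_iff_of_nonneg (norm_nonneg p) two_ne_zero).1
      (sub_pos.1 ((Real.exp_pos _).trans_le h))
    exact ⟨hp, (conformalGauge_le_iff hp).2 h⟩
  rw [hset]
  exact isClosed_le continuous_const (by fun_prop)

lemma norm_chordDir_sub_hDir_le_of_conformalGauge_le (hp : ‖p‖ < 1) (hq : ‖q‖ < 1) (hpq : p ≠ q)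
    {R : ℝ} (hR : conformalGauge p ≤ R) :
    ‖chordDir p q - hDir p q‖ ≤ 2 * Real.exp R * hDist p q := by
  have hexp : Real.exp (-R) ≤ 1 - ‖p‖ ^ 2 := (conformalGauge_le_iff hp).1 hR
  have hmul : Real.exp (-R) * ‖chordDir p q - hDir p q‖ ≤ 2 * hDist p q :=
    (mul_le_mul_of_nonneg_right hexp (norm_nonneg _)).trans (norm_chordDir_sub_hDir_le hp hq hpq)
  rw [Real.exp_neg, inv_mul_le_iff₀ (Real.exp_pos R)] at hmul
  linarith

lemma norm_chordDir_sub_chordDir_le_of_conformalGauge_le {a b : ℂ} (ha : ‖a‖ < 1) (hp : ‖p‖ < 1)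
    (hb : ‖b‖ < 1) (hap : a ≠ p) (hpb : p ≠ b) {R : ℝ} (hR : conformalGauge p ≤ R) :
    ‖chordDir p b - chordDir a p‖ ≤
      |planeAngle (-hDir p a) (hDir p b)| + 2 * Real.exp R * (hDist a p + hDist p b) := by
  have hturn := norm_sub_le_abs_planeAngle (v := -hDir p a) (w := hDir p b)
    (by rw [norm_neg, norm_hDir hp ha hap.symm]) (norm_hDir hp hb hpb)
  have hsplit : chordDir p b - chordDir a p = (chordDir p b - hDir p b) +
      (chordDir p a - hDir p a) + (hDir p b - -hDir p a) := by
    rw [chordDir_comm p a]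
    ring
  rw [hsplit, hDist_comm a p]
  linarith [norm_add₃_le (a := chordDir p b - hDir p b) (b := chordDir p a - hDir p a)
    (c := hDir p b - -hDir p a), norm_chordDir_sub_hDir_le_of_conformalGauge_le hp hb hpb hR,
    norm_chordDir_sub_hDir_le_of_conformalGauge_le hp ha hap.symm hR]

end HyperbolicDistance

section HyperbolicInsertion

variable {p q : ℂ} {α β : ℝ}

/-- The position of the inserted vertex relative to `p`, i.e. after the left translation of the
Poincaré disk taking `p` to the origin. -/
def hOffset (p q : ℂ) (α : ℝ) : ℂ := (Real.tanh (hNew p q α / 2) : ℂ) * rot α (hDir p q)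

/-- The vertex insertion `hyperbolicPlane.insertPt`, typed on `ℂ` instead of `hyperbolicPlane.V` so
that complex arithmetic applies to it. -/
def hInsert (p q : ℂ) (α : ℝ) : ℂ := mobiusAdd p (hOffset p q α)

lemma cos_alphaMax_le (hα : α ∈ admissibleAngles) : Real.cos alphaMax ≤ Real.cos α := by
  rw [← Real.cos_abs α]
  exact Real.cos_le_cos_of_nonneg_of_le_pi (abs_nonneg α)
    (by unfold alphaMax; linarith [Real.pi_pos]) (abs_le.2 hα)

lemma norm_mul_inv_cos_mem_Ioo (hp : ‖p‖ < 1) (hq : ‖q‖ < 1) (h : hyperbolicPlane.goodEdge p q)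
    (hα : α ∈ admissibleAngles) :
    ‖mobiusAdd (-p) q‖ * (Real.cos α)⁻¹ ∈ Set.Ioo (0 : ℝ) 1 := by
  have hcos := cos_pos_of_mem_admissibleAngles hα
  have hgood : Real.tanh (hDist p q / 2) < Real.cos alphaMax := h.2
  rw [tanh_half_hDist hp hq] at hgood
  refine ⟨mul_pos (norm_mobiusAdd_neg_pos hp hq h.1) (inv_pos.2 hcos), ?_⟩
  rw [mul_inv_lt_iff₀ hcos, one_mul]
  exact hgood.trans_le (cos_alphaMax_le hα)

lemma hNew_eq (hp : ‖p‖ < 1) (hq : ‖q‖ < 1) (α : ℝ) :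
    hNew p q α = Real.artanh (‖mobiusAdd (-p) q‖ * (Real.cos α)⁻¹) := by
  rw [hNew, tanh_half_hDist hp hq, div_eq_mul_inv]

lemma tanh_half_hNew_pos (hp : ‖p‖ < 1) (hq : ‖q‖ < 1) (h : hyperbolicPlane.goodEdge p q)
    (hα : α ∈ admissibleAngles) : 0 < Real.tanh (hNew p q α / 2) := by
  have hpos : 0 < hNew p q α := by
    rw [hNew_eq hp hq]
    exact Real.artanh_pos (norm_mul_inv_cos_mem_Ioo hp hq h hα)
  rw [Real.tanh_eq_sinh_div_cosh]
  exact div_pos (Real.sinh_pos_iff.2 (half_pos hpos)) (Real.cosh_pos _)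

lemma two_mul_tanh_half_hNew_mul_cos (hp : ‖p‖ < 1) (hq : ‖q‖ < 1)
    (h : hyperbolicPlane.goodEdge p q) (hα : α ∈ admissibleAngles) :
    2 * (Real.tanh (hNew p q α / 2) * Real.cos α) =
      ‖mobiusAdd (-p) q‖ * (1 + Real.tanh (hNew p q α / 2) ^ 2) := by
  have hmem := norm_mul_inv_cos_mem_Ioo hp hq h hα
  have htanh : Real.tanh (hNew p q α) = ‖mobiusAdd (-p) q‖ * (Real.cos α)⁻¹ := by
    rw [hNew_eq hp hq, Real.tanh_artanh ⟨by linarith [hmem.1], hmem.2⟩]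
  rw [← mul_assoc, ← tanh_mul_one_add_sq_tanh_half, htanh]
  field_simp [(cos_pos_of_mem_admissibleAngles hα).ne']

lemma norm_hOffset (hp : ‖p‖ < 1) (hq : ‖q‖ < 1) (h : hyperbolicPlane.goodEdge p q)
    (hα : α ∈ admissibleAngles) : ‖hOffset p q α‖ = Real.tanh (hNew p q α / 2) := by
  rw [hOffset, norm_mul, norm_rot, norm_hDir hp hq h.1, mul_one, Complex.norm_real,
    Real.norm_of_nonneg (tanh_half_hNew_pos hp hq h hα).le]

lemma norm_hOffset_lt_one (hp : ‖p‖ < 1) (hq : ‖q‖ < 1) (h : hyperbolicPlane.goodEdge p q)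
    (hα : α ∈ admissibleAngles) : ‖hOffset p q α‖ < 1 :=
  (norm_hOffset hp hq h hα).trans_lt (Real.tanh_lt_one _)

lemma norm_hInsert_lt_one (hp : ‖p‖ < 1) (hq : ‖q‖ < 1) (h : hyperbolicPlane.goodEdge p q)
    (hα : α ∈ admissibleAngles) : ‖hInsert p q α‖ < 1 :=
  norm_mobiusAdd_lt_one hp (norm_hOffset_lt_one hp hq h hα)

lemma conj_mul_rot_mul_mul {v : ℂ} (hv : ‖v‖ = 1) (t τ α : ℝ) :
    conj (τ * rot α v) * (t * v) = t * τ * (Complex.cos α - Complex.sin α * Complex.I) := by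
  have hvv : conj v * v = 1 := by rw [mul_comm, Complex.mul_conj', hv, Complex.ofReal_one, one_pow]
  simp only [rot_eq, map_mul, map_add, Complex.conj_ofReal, Complex.conj_I]
  push_cast
  linear_combination (t * τ * (Complex.cos α - Complex.sin α * Complex.I)) * hvv

-- Writing `ε = exp (-α * I)` and `z = 1 - t * τ * ε`, the length relation says that
-- `t - τ * exp (α * I) = τ * ε * conj z`, so the second leg has direction `v * ε * conj z / z`.
lemma exists_mobiusAdd_neg_eq_mul_of_isosceles {v : ℂ} {t τ : ℝ} (hv : ‖v‖ = 1)
    (hτ : ‖(τ * rot α v : ℂ)‖ < 1) (ht : ‖(t * v : ℂ)‖ < 1)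
    (hlegs : 2 * (τ * Real.cos α) = t * (1 + τ ^ 2)) :
    ∃ u : ℂ, ‖u‖ = 1 ∧ |Real.sin α| ≤ ‖u - rot α v‖ ∧
      mobiusAdd (-(τ * rot α v)) (t * v) = τ * u := by
  set ε : ℂ := Complex.cos α - Complex.sin α * Complex.I with hε
  set z : ℂ := 1 - t * τ * ε with hz
  have hden : 1 - conj (τ * rot α v) * (t * v) = z := by rw [conj_mul_rot_mul_mul hv]
  have hz_ne : z ≠ 0 := hden ▸ one_sub_conj_mul_ne_zero hτ ht
  have hz_le : ‖z‖ ≤ 2 := by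
    rw [← hden]
    linarith [norm_sub_le 1 (conj (τ * rot α v) * (t * v)), norm_conj_mul_lt_one hτ ht,
      norm_one (α := ℂ)]
  have hconj : conj z = 1 - t * τ * (Complex.cos α + Complex.sin α * Complex.I) := by
    simp only [hz, hε, map_sub, map_mul, map_one, Complex.conj_ofReal, Complex.conj_I,
      ← Complex.ofReal_cos, ← Complex.ofReal_sin]
    ring
  have hε_norm : ‖ε‖ = 1 := by
    simpa [hε, rot_eq, sub_eq_add_neg] using norm_rot (-α) 1
  have hpyth := Complex.sin_sq_add_cos_sq α
  have hlegs' : 2 * (τ * Complex.cos α) = t * (1 + τ ^ 2) := by exact_mod_cast hlegs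
  refine ⟨v * ε * (conj z / z), ?_, ?_, ?_⟩
  · rw [norm_mul, norm_mul, norm_div, RCLike.norm_conj, div_self (norm_ne_zero_iff.2 hz_ne), hv,
      hε_norm, one_mul, one_mul]
  · have hdiff : (v * ε * (conj z / z) - rot α v) * z = -(2 * Real.sin α * Complex.I) * v := by
      rw [sub_mul, mul_assoc, div_mul_cancel₀ _ hz_ne, hconj, rot_eq, hz, hε]
      push_cast
      ring
    have hnorm := congr_arg norm hdiff
    rw [norm_mul, norm_mul, norm_neg, norm_mul, norm_mul, Complex.norm_I, Complex.norm_real, hv,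
      Complex.norm_ofNat, Real.norm_eq_abs] at hnorm
    linarith [mul_le_mul_of_nonneg_left hz_le (norm_nonneg (v * ε * (conj z / z) - rot α v))]
  · rw [mobiusAdd_neg, hden, div_eq_iff hz_ne, mul_assoc, mul_assoc, div_mul_cancel₀ _ hz_ne, hconj,
      rot_eq, hε]
    push_cast
    linear_combination (-v) * hlegs' + t * τ ^ 2 * v * hpyth +
      (-t * τ ^ 2 * v * Complex.sin α ^ 2) * Complex.I_sq

lemma exists_mobiusAdd_neg_hInsert_eq (hp : ‖p‖ < 1) (hq : ‖q‖ < 1)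
    (h : hyperbolicPlane.goodEdge p q) (hα : α ∈ admissibleAngles) :
    ∃ u v : ℂ, ‖u‖ = 1 ∧ ‖v‖ = 1 ∧ |Real.sin α| ≤ ‖u - v‖ ∧
      mobiusAdd (-hInsert p q α) q = Real.tanh (hNew p q α / 2) * u ∧
      mobiusAdd (-hInsert p q α) p = Real.tanh (hNew p q α / 2) * -v := by
  have hw := norm_hOffset_lt_one hp hq h hα
  have hb := norm_mobiusAdd_neg_lt_one hp hq
  have hD := norm_hDir hp hq h.1
  have hg := norm_gyration hp hw
  have hbD := norm_mul_hDir hp hq h.1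
  obtain ⟨u, hu, hsin, hleg⟩ := exists_mobiusAdd_neg_eq_mul_of_isosceles hD hw (by rwa [hbD])
    (two_mul_tanh_half_hNew_mul_cos hp hq h hα)
  refine ⟨gyration p (hOffset p q α) * u, gyration p (hOffset p q α) * rot α (hDir p q), ?_, ?_, ?_,
    ?_, ?_⟩
  · rw [norm_mul, hg, hu, one_mul]
  · rw [norm_mul, hg, norm_rot, hD, one_mul]
  · rwa [← mul_sub, norm_mul, hg, one_mul]
  · rw [hbD, ← hOffset] at hleg
    have hright := mobiusAdd_neg_mobiusAdd hp hw hb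
    rw [mobiusAdd_cancel hp hq, hleg] at hright
    rw [hInsert, hright, mul_left_comm]
  · have hleft := mobiusAdd_neg_mobiusAdd hp hw (norm_zero.trans_lt one_pos)
    rw [mobiusAdd_zero, mobiusAdd_zero] at hleft
    rw [hInsert, hleft, hOffset]
    ring

lemma hDist_left_hInsert (hp : ‖p‖ < 1) (hq : ‖q‖ < 1) (h : hyperbolicPlane.goodEdge p q)
    (hα : α ∈ admissibleAngles) : hDist p (hInsert p q α) = hNew p q α := by
  rw [hDist, hInsert, mobiusAdd_neg_cancel hp (norm_hOffset_lt_one hp hq h hα),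
    norm_hOffset hp hq h hα, Real.artanh_tanh, mul_div_cancel₀ _ two_ne_zero]

lemma hDist_hInsert_right (hp : ‖p‖ < 1) (hq : ‖q‖ < 1) (h : hyperbolicPlane.goodEdge p q)
    (hα : α ∈ admissibleAngles) : hDist (hInsert p q α) q = hNew p q α := by
  obtain ⟨u, -, hu, -, -, hright, -⟩ := exists_mobiusAdd_neg_hInsert_eq hp hq h hα
  rw [hDist, hright, norm_mul, hu, mul_one, Complex.norm_real,
    Real.norm_of_nonneg (tanh_half_hNew_pos hp hq h hα).le, Real.artanh_tanh,
    mul_div_cancel₀ _ two_ne_zero]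

lemma abs_sin_le_planeAngle_hInsert (hp : ‖p‖ < 1) (hq : ‖q‖ < 1)
    (h : hyperbolicPlane.goodEdge p q) (hα : α ∈ admissibleAngles) :
    |Real.sin α| ≤ |planeAngle (-hDir (hInsert p q α) p) (hDir (hInsert p q α) q)| := by
  obtain ⟨u, v, hu, hv, hsin, hright, hleft⟩ := exists_mobiusAdd_neg_hInsert_eq hp hq h hα
  have hτ := tanh_half_hNew_pos hp hq h hα
  rw [hDir_eq_of_mobiusAdd_neg_eq hτ hu hright,
    hDir_eq_of_mobiusAdd_neg_eq hτ (by rwa [norm_neg]) hleft, neg_neg]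
  exact hsin.trans (norm_sub_le_abs_planeAngle hv hu)

lemma norm_mul_inv_cos_le (hp : ‖p‖ < 1) (hq : ‖q‖ < 1) (hα : α ∈ admissibleAngles) :
    ‖mobiusAdd (-p) q‖ * (Real.cos α)⁻¹ ≤ 3 / 4 * hDist p q := by
  have hcos := inv_cos_le_three_halves hα
  have ht := two_mul_norm_mobiusAdd_neg_le hp hq
  calc ‖mobiusAdd (-p) q‖ * (Real.cos α)⁻¹ ≤ hDist p q / 2 * (3 / 2) :=
        mul_le_mul (by linarith) hcos (inv_pos.2 (cos_pos_of_mem_admissibleAngles hα)).le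
          (by linarith [norm_nonneg (mobiusAdd (-p) q)])
    _ = 3 / 4 * hDist p q := by ring

lemma hNew_le (hp : ‖p‖ < 1) (hq : ‖q‖ < 1) (h : hyperbolicPlane.goodEdge p q)
    (hα : α ∈ admissibleAngles) (he : hDist p q ≤ 1 / 6) :
    hNew p q α ≤ hDist p q / 2 * (1 + 6 * (hDist p q + |Real.sin α|)) := by
  have hpos := hDist_pos hp hq h.1
  have hsin := abs_nonneg (Real.sin α)
  have hy := (norm_mul_inv_cos_mem_Ioo hp hq h hα).1.le
  have hy' := norm_mul_inv_cos_le hp hq hα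
  have hratio : ‖mobiusAdd (-p) q‖ * (Real.cos α)⁻¹ ≤
      hDist p q / 2 * (1 + 3 / 2 * |Real.sin α|) :=
    mul_le_mul (by linarith [two_mul_norm_mobiusAdd_neg_le hp hq]) (inv_cos_le hα)
      (inv_pos.2 (cos_pos_of_mem_admissibleAngles hα)).le (by linarith)
  rw [hNew_eq hp hq]
  calc _ ≤ _ * (1 + 2 * (‖mobiusAdd (-p) q‖ * (Real.cos α)⁻¹)) :=
        artanh_le_mul_one_add hy (by linarith)
    _ ≤ hDist p q / 2 * (1 + 3 / 2 * |Real.sin α|) * (1 + 2 * (3 / 4 * hDist p q)) := by gcongr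
    _ ≤ hDist p q / 2 * (1 + 6 * (hDist p q + |Real.sin α|)) := by
      rw [mul_assoc]
      gcongr
      linarith [mul_le_mul_of_nonneg_right he hsin]

lemma tanh_half_hNew_le (hp : ‖p‖ < 1) (hq : ‖q‖ < 1) (h : hyperbolicPlane.goodEdge p q)
    (hα : α ∈ admissibleAngles) : Real.tanh (hNew p q α / 2) ≤ 3 / 4 * hDist p q := by
  have hτ := tanh_half_hNew_pos hp hq h hα
  have hτ' : Real.tanh (hNew p q α / 2) ^ 2 ≤ 1 := pow_le_one₀ hτ.le (Real.tanh_lt_one _).le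
  have hlegs := two_mul_tanh_half_hNew_mul_cos hp hq h hα
  have hcos := cos_pos_of_mem_admissibleAngles hα
  refine le_trans ?_ (norm_mul_inv_cos_le hp hq hα)
  rw [← div_eq_mul_inv, le_div_iff₀ hcos]
  linarith [mul_le_mul_of_nonneg_left hτ' (norm_nonneg (mobiusAdd (-p) q))]

lemma norm_hOffset_sub_hOffset_le (hp : ‖p‖ < 1) (hq : ‖q‖ < 1)
    (h : hyperbolicPlane.goodEdge p q) (hα : α ∈ admissibleAngles) (hβ : β ∈ admissibleAngles)
    (he : hDist p q ≤ 1 / 6) :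
    ‖hOffset p q β - hOffset p q α‖ ≤
      3 / 4 * hDist p q * (hDist p q + |Real.sin α| + |Real.sin β|) := by
  have hpos := hDist_pos hp hq h.1
  have ht := two_mul_norm_mobiusAdd_neg_le hp hq
  have hα_legs := two_mul_tanh_half_hNew_mul_cos hp hq h hα
  have hβ_legs := two_mul_tanh_half_hNew_mul_cos hp hq h hβ
  have hτ := tanh_half_hNew_pos hp hq h hα
  have hτ' := tanh_half_hNew_le hp hq h hα
  have hσ := tanh_half_hNew_pos hp hq h hβ
  have hσ' := tanh_half_hNew_le hp hq h hβ
  set τ := Real.tanh (hNew p q α / 2) with hτ_def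
  set σ := Real.tanh (hNew p q β / 2) with hσ_def
  have hdiff : hOffset p q β - hOffset p q α =
      ((‖mobiusAdd (-p) q‖ / 2 * (σ ^ 2 - τ ^ 2) : ℝ) +
        (σ * Real.sin β - τ * Real.sin α : ℝ) * Complex.I) * hDir p q := by
    rw [show ‖mobiusAdd (-p) q‖ / 2 * (σ ^ 2 - τ ^ 2) = σ * Real.cos β - τ * Real.cos α by linarith,
      hOffset, hOffset, rot_eq, rot_eq, ← hτ_def, ← hσ_def]
    push_cast
    ring
  have hbase : |‖mobiusAdd (-p) q‖ / 2 * (σ ^ 2 - τ ^ 2)| ≤ 3 / 4 * hDist p q * hDist p q := by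
    have hsq : |σ ^ 2 - τ ^ 2| ≤ hDist p q ^ 2 := by
      rw [abs_le]
      constructor <;> nlinarith
    rw [abs_mul, abs_of_nonneg (by positivity)]
    nlinarith [mul_le_mul (by linarith : ‖mobiusAdd (-p) q‖ / 2 ≤ 3 / 4) hsq (abs_nonneg _)
      (by norm_num)]
  have hheight : |σ * Real.sin β - τ * Real.sin α| ≤
      3 / 4 * hDist p q * |Real.sin β| + 3 / 4 * hDist p q * |Real.sin α| := by
    refine (abs_sub _ _).trans ?_
    rw [abs_mul, abs_mul, abs_of_pos hτ, abs_of_pos hσ]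
    gcongr
  rw [hdiff, norm_mul, norm_hDir hp hq h.1, mul_one]
  refine (norm_add_le _ _).trans ?_
  rw [norm_mul, Complex.norm_I, mul_one, Complex.norm_real, Complex.norm_real, Real.norm_eq_abs,
    Real.norm_eq_abs]
  linarith

lemma norm_mobiusAdd_neg_le_two_mul {z w : ℂ} (hz : ‖z‖ ≤ 1 / 2) (hw : ‖w‖ ≤ 1 / 2) :
    ‖mobiusAdd (-z) w‖ ≤ 2 * ‖w - z‖ := by
  have hprod : ‖conj z * w‖ ≤ 1 / 2 := by
    rw [norm_mul, RCLike.norm_conj]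
    nlinarith [norm_nonneg w]
  have hden : 1 / 2 ≤ ‖1 - conj z * w‖ := by
    linarith [norm_sub_norm_le 1 (conj z * w), norm_one (α := ℂ)]
  rw [mobiusAdd_neg, norm_div, div_le_iff₀ (by linarith)]
  nlinarith [norm_nonneg (w - z)]

lemma hDist_hInsert_hInsert_le (hp : ‖p‖ < 1) (hq : ‖q‖ < 1)
    (h : hyperbolicPlane.goodEdge p q) (hα : α ∈ admissibleAngles) (hβ : β ∈ admissibleAngles)
    (he : hDist p q ≤ 1 / 6) :
    hDist (hInsert p q α) (hInsert p q β) ≤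
      6 * hDist p q * (hDist p q + |Real.sin α| + |Real.sin β|) := by
  have hα_lt := norm_hOffset_lt_one hp hq h hα
  have hsmall {γ : ℝ} (hγ : γ ∈ admissibleAngles) : ‖hOffset p q γ‖ ≤ 1 / 8 := by
    rw [norm_hOffset hp hq h hγ]
    linarith [tanh_half_hNew_le hp hq h hγ]
  have hα_small := hsmall hα
  have hβ_small := hsmall hβ
  have hmobius := norm_mobiusAdd_neg_le_two_mul (hα_small.trans (by norm_num))
    (hβ_small.trans (by norm_num))
  have hartanh := artanh_le_two_mul (norm_nonneg (mobiusAdd (-hOffset p q α) (hOffset p q β)))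
    (by linarith [norm_sub_le (hOffset p q β) (hOffset p q α)])
  rw [hDist, hInsert, hInsert, mobiusAdd_neg_mobiusAdd hp hα_lt (norm_hOffset_lt_one hp hq h hβ),
    norm_mul, norm_gyration hp hα_lt, one_mul]
  linarith [norm_hOffset_sub_hOffset_le hp hq h hα hβ he]

lemma norm_lt_one_of_mem_hyperbolicPlane {p : ℂ} (hp : p ∈ hyperbolicPlane.carrier) : ‖p‖ < 1 :=
  mem_ball_zero_iff.1 hp

lemma hasLocalEstimates_hyperbolicPlane :
    HasLocalEstimates hyperbolicPlane conformalGauge 6 (1 / 6) where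
  nonneg := by norm_num
  pos := by norm_num
  gdist_self {p : ℂ} _ := by
    change 2 * Real.artanh ‖mobiusAdd (-p) p‖ = 0
    rw [mobiusAdd_neg, sub_self, zero_div, norm_zero, Real.artanh_zero, mul_zero]
  gdist_pos hp hq h := hDist_pos (norm_lt_one_of_mem_hyperbolicPlane hp)
    (norm_lt_one_of_mem_hyperbolicPlane hq) h.1
  ne_of_goodEdge h := h.1
  insertPt_mem hp hq h hα := mem_ball_zero_iff.2 (norm_hInsert_lt_one
    (norm_lt_one_of_mem_hyperbolicPlane hp) (norm_lt_one_of_mem_hyperbolicPlane hq) h hα)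
  gdist_left_le hp hq h hα he :=
    have hp := norm_lt_one_of_mem_hyperbolicPlane hp
    have hq := norm_lt_one_of_mem_hyperbolicPlane hq
    (hDist_left_hInsert hp hq h hα).trans_le (hNew_le hp hq h hα he)
  gdist_right_le hp hq h hα he :=
    have hp := norm_lt_one_of_mem_hyperbolicPlane hp
    have hq := norm_lt_one_of_mem_hyperbolicPlane hq
    (hDist_hInsert_right hp hq h hα).trans_le (hNew_le hp hq h hα he)
  abs_sin_le {p q : ℂ} {α} hp hq h hα := by
    have hp := norm_lt_one_of_mem_hyperbolicPlane hp
    have hq := norm_lt_one_of_mem_hyperbolicPlane hq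
    change |Real.sin α| ≤
      6 * (|planeAngle (-hDir (hInsert p q α) p) (hDir (hInsert p q α) q)| + hDist p q)
    linarith [abs_sin_le_planeAngle_hInsert hp hq h hα, hDist_pos hp hq h.1,
      abs_nonneg (planeAngle (-hDir (hInsert p q α) p) (hDir (hInsert p q α) q))]
  gdist_insertPt_le hp hq h hα hβ he := hDist_hInsert_hInsert_le
    (norm_lt_one_of_mem_hyperbolicPlane hp) (norm_lt_one_of_mem_hyperbolicPlane hq) h hα hβ he
  gauge_le hp hq := conformalGauge_le_add_hDist (norm_lt_one_of_mem_hyperbolicPlane hp)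
    (norm_lt_one_of_mem_hyperbolicPlane hq)
  isClosed_gauge_le := isClosed_conformalGauge_le
  exists_chord_le R := by
    refine ⟨1 + 2 * Real.exp R, by positivity,
      fun (a p b : ℂ) ha hp hb _ hpR _ hap hpb => ?_⟩
    have ha := norm_lt_one_of_mem_hyperbolicPlane ha
    have hp := norm_lt_one_of_mem_hyperbolicPlane hp
    have hb := norm_lt_one_of_mem_hyperbolicPlane hb
    have hap_pos := hDist_pos ha hp hap.1
    have hpb_pos := hDist_pos hp hb hpb.1
    constructor
    · exact (norm_sub_le_hDist hp hb).trans (le_mul_of_one_le_left hpb_pos.le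
        (le_add_of_nonneg_right (by positivity)))
    · refine (norm_chordDir_sub_chordDir_le_of_conformalGauge_le ha hp hb hap.1 hpb.1 hpR).trans
        (add_le_add_right (mul_le_mul_of_nonneg_right ?_ (add_pos hap_pos hpb_pos).le) _)
      linarith

end HyperbolicInsertion

lemma Geometry.exists_hasLocalEstimates (G : Geometry) :
    ∃ ρ B η, HasLocalEstimates G.model ρ B η := by
  cases G
  · exact ⟨_, _, _, hasLocalEstimates_euclideanPlane⟩
  · exact ⟨_, _, _, hasLocalEstimates_sphere⟩
  · exact ⟨_, _, _, hasLocalEstimates_hyperbolicPlane⟩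

lemma Geometry.completeSpace_model (G : Geometry) : CompleteSpace G.model.V := by
  cases G
  · exact inferInstanceAs (CompleteSpace ℂ)
  · exact inferInstanceAs (CompleteSpace R3)
  · exact inferInstanceAs (CompleteSpace ℂ)

end AngleSubdivision

end

open AngleSubdivision in
theorem corollary1 (G : Geometry) (s : ℝ) (hs : s = 1 ∨ s = -1) (K : ℝ) :
    ∃ C η : ℝ, 0 < η ∧
      ∀ (f : (Fin 7 → ℝ) → ℝ) (_ : ∀ x, f x ∈ admissibleAngles)
        (N : ℕ) (P : ℤ → G.model.V) (_ : IsClosedPolygon G.model N P)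
        (_ : ∀ k j, G.model.goodEdge (neuralIter G.model s f N P k j)
          (neuralIter G.model s f N P k (j + 1)))
        (_ : AngleDecay G.model K N (neuralIter G.model s f N P)),
        (∀ k, meshWidth G.model (N * 2 ^ k) (neuralIter G.model s f N P k) ≤ η → ∀ j,
          G.model.gdist
              (neuralStep G.model s f (N * 2 ^ k) (neuralIter G.model s f N P k) j)
              (fourPointStep G.model s (neuralIter G.model s f N P k) j)
            ≤ C * meshWidth G.model (N * 2 ^ k) (neuralIter G.model s f N P k) ^ 2) ∧
        (∃ C' : ℝ, ∀ k j,
          G.model.gdist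
              (neuralStep G.model s f (N * 2 ^ k) (neuralIter G.model s f N P k) j)
              (fourPointStep G.model s (neuralIter G.model s f N P k) j)
            ≤ C' * meshWidth G.model (N * 2 ^ k) (neuralIter G.model s f N P k) ^ 2) ∧
        HasC1LimitCurve G.model N (neuralIter G.model s f N P) := by
  obtain ⟨ρ, B, η, hM⟩ := G.exists_hasLocalEstimates
  have := G.completeSpace_model
  refine ⟨B * (1 + angleRate B η K + Real.pi * K), η, hM.pos, fun f hf N P hP hgood hdecay => ?_⟩
  have H := isInsertionSequence_neuralIter hs hf hP hgood hdecay
  exact ⟨fun k hk j => H.gdist_fourPointStep_le hM hk j, H.exists_gdist_fourPointStep_le hM,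
    H.hasC1LimitCurve hM⟩
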